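/- Let $p\ge 0$, $[p]=\{1,\dots,p\}$, and let $\mathbf X$ be a random vector with values in $[-1,1]^p$ whose law is $\mu_f=f\lambda$, where $\lambda$ is Lebesgue measure on $[-1,1]^p$ and the (measurable) density $f$ satisfies $0<c_1\le f(\mathbf x)\le c_2<\infty$ for all $\mathbf x\in[-1,1]^p$. Write $L^2=L^2([-1,1]^p,\mu_f)$ (real valued functions), and for $S\subseteq[p]$ let $L^2_S\subseteq L^2$ be the subspace of functions of $\mathbf x_S=(x_j)_{j\in S}$ only, and let $f_S(\mathbf x_S)=\int_{[-1,1]^{[p]\setminus S}} f(\mathbf x)\,d\mathbf x_{[p]\setminus S}$ be the marginal density of $\mathbf X_S$. Let $P_m$ be the Legendre polynomials ($P_0=1$, $P_1=X$, $(m+1)P_{m+1}=(2m+1)XP_m-mP_{m-1}$ for $m\ge1$) and $\widetilde P_m=\sqrt{(2m+1)/2}\,P_m$. For $\emptyset\ne S\subseteq[p]$ and $\mathbf m_S=(m_j)_{j\in S}\in\mathbb N_+^{S}$ (positive integers) put $$\xi_S^{(\mathbf m_S)}(\mathbf x)=\frac{1}{\sqrt{2^{p-|S|}}}\cdot\frac{\prod_{j\in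 S}\widetilde P_{m_j}(x_j)}{f_S(\mathbf x_S)},$$ and let $\xi_\emptyset$ be the constant function $1$ or the constant function $2^{-p/2}$ (the value of the formula at $S=\emptyset$); the statement holds for either normalization. Call a family $(g_S)_{S\subseteq[p]}$ with $g_S\in L^2_S$ for all $S$ feasible (hierarchically orthogonal) if $\int g_S\,h\,d\mu_f=0$ for all $T\subsetneq S\subseteq[p]$ and all $h\in L^2_T$. Then all $\xi_S^{(\mathbf m_S)}$ belong to $L^2$, and the family $\Xi=(\xi_S^{(\mathbf m_S)})_{S\subseteq[p],\,\mathbf m_S\in\mathbb N_+^S}$ is a Riesz basis of $L^2$, i.e. the image of an orthonormal Hilbert basis of $L^2$ under a bounded linear automorphism of $L^2$ with bounded inverse. Moreover, for every $\nu\in L^2$ there are coefficients $\mathbf a=(a_S^{(\mathbf m_S)})$ and components $(\nu_S)_{S\subseteq[p]}$ such that: 1. $\mathbf a$ is the unique family of reals with $\nu=\sum_{S\subseteq[p]}\sum_{\mathbf m_S} a_S^{(\mathbf m_S)}\xi_S^{(\mathbf m_S)}$ (unconditional convergence in $L^2$); 2. $(\nu_S)_S$ is the unique minimizer of $\int\big(\sum_{S\subseteq[p]}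 g_S-\nu\big)^2d\mu_f$ over all feasible families $(g_S)_S$; 3. $(\nu_S)_S$ is the unique feasible family with $\nu=\sum_{S\subseteq[p]}\nu_S$; 4. $\mathbf a$ is the unique family of reals with $\nu_S=\sum_{\mathbf m_S\in\mathbb N_+^{S}}a_S^{(\mathbf m_S)}\xi_S^{(\mathbf m_S)}$ for all $S\subseteq[p]$ (unconditional convergence in $L^2$). -/

import Mathlib

open MeasureTheory

noncomputable section

namespace FANOVA

/-- The Legendre polynomials on `[-1,1]`, by the three-term recurrence
`(m+1) P_{m+1} = (2m+1) X P_m - m P_{m-1}` (read with `m = n + 1`). -/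
def legendre : ℕ → Polynomial ℝ
  | 0 => 1
  | 1 => Polynomial.X
  | n + 2 => Polynomial.C (1 / ((n : ℝ) + 2)) *
      (Polynomial.C (2 * (n : ℝ) + 3) * Polynomial.X * legendre (n + 1)
        - Polynomial.C ((n : ℝ) + 1) * legendre n)

/-- The normalized Legendre polynomial `√((2m+1)/2) P_m`, as a function. -/
def normLegendre (m : ℕ) (t : ℝ) : ℝ :=
  Real.sqrt ((2 * (m : ℝ) + 1) / 2) * (legendre m).eval t

/-- The measure `μ_f = f λ` on the cube `[-1,1]^p`, the law of the random vector with density `f`.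
Only the values of `f` on the cube matter. -/
def muF {p : ℕ} (f : (Fin p → ℝ) → ℝ) : Measure (Fin p → ℝ) :=
  (volume.restrict (Set.Icc (-1) 1)).withDensity (fun x => ENNReal.ofReal (f x))

/-- The Hilbert space `L² = L²([-1,1]^p, μ_f)`. -/
abbrev L2 {p : ℕ} (f : (Fin p → ℝ) → ℝ) : Type := Lp ℝ 2 (muF f)

/-- The marginal density `f_S(x_S)`: the integral of `f` over the coordinates outside `S`. -/
def marginal {p : ℕ} (f : (Fin p → ℝ) → ℝ) (S : Finset (Fin p)) (xS : {j // j ∈ S} → ℝ) : ℝ :=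
  ∫ y : ({j // ¬ j ∈ S} → ℝ) in Set.Icc (-1) 1,
    f ((MeasurableEquiv.piEquivPiSubtypeProd (fun _ : Fin p => ℝ) (fun j => j ∈ S)).symm (xS, y))

/-- The index set of the family `Ξ`: pairs `(S, m_S)` with `S ⊆ [p]` and `m_S ∈ ℕ₊^S`. -/
abbrev Idx (p : ℕ) : Type := Σ S : Finset (Fin p), ({j // j ∈ S} → ℕ+)

/-- The function `ξ_S^{(m_S)} = 2^{-(p-|S|)/2} ∏_{j ∈ S} P̃_{m_j}(x_j) / f_S(x_S)` for nonempty `S`;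
`κ` is the value of the constant function `ξ_∅`. (The general formula would give
`κ = 2^{-p/2}` at `S = ∅`, another usual normalization is `κ = 1`.) -/
def xi {p : ℕ} (f : (Fin p → ℝ) → ℝ) (κ : ℝ) (i : Idx p) (x : Fin p → ℝ) : ℝ :=
  if i.1 = ∅ then κ
  else 1 / Real.sqrt (2 ^ (p - i.1.card)) *
    ((∏ j : {j // j ∈ i.1}, normLegendre (i.2 j) (x j)) / marginal f i.1 (i.1.restrict x))

/-- A family is a Riesz basis if it is the image of a Hilbert (orthonormal) basis under a bounded
invertible linear operator. -/
def IsRieszBasis {ι H : Type} [NormedAddCommGroup H] [InnerProductSpace ℝ H] (v : ι → H) : Prop :=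
  ∃ (b : HilbertBasis ι ℝ H) (T : H ≃L[ℝ] H), ∀ i, v i = T (b i)

/-- `L²_S`: the square integrable functions that depend on `x_S` only. -/
def L2S {p : ℕ} (f : (Fin p → ℝ) → ℝ) (S : Finset (Fin p)) : Submodule ℝ (L2 f) where
  carrier := {g | ∃ h : ({j // j ∈ S} → ℝ) → ℝ, Measurable h ∧
    ∀ᵐ x ∂(muF f), g x = h (S.restrict x)}
  zero_mem' := ⟨0, measurable_zero, by
    filter_upwards [Lp.coeFn_zero ℝ 2 (muF f)] with x hx
    simpa using hx⟩
  add_mem' := by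
    rintro a b ⟨h, hm, hh⟩ ⟨k, km, hk⟩
    refine ⟨h + k, hm.add km, ?_⟩
    filter_upwards [Lp.coeFn_add a b, hh, hk] with x hx h1 h2
    rw [hx, Pi.add_apply, h1, h2, Pi.add_apply]
  smul_mem' := by
    rintro c a ⟨h, hm, hh⟩
    refine ⟨c • h, hm.const_smul c, ?_⟩
    filter_upwards [Lp.coeFn_smul c a, hh] with x hx h1
    rw [hx, Pi.smul_apply, h1, Pi.smul_apply]

/-- The feasible families of the generalized functional ANOVA problem: `g_S ∈ L²_S` for all `S`,
together with the hierarchical orthogonality constraint. -/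
def Feasible {p : ℕ} (f : (Fin p → ℝ) → ℝ) (g : Finset (Fin p) → L2 f) : Prop :=
  (∀ S, g S ∈ L2S f S) ∧
    ∀ T S : Finset (Fin p), T ⊂ S → ∀ h ∈ L2S f T, ∫ x, g S x * h x ∂(muF f) = 0

/-- The objective `∫ (∑_S g_S - ν)² dμ_f`. -/
def objective {p : ℕ} (f : (Fin p → ℝ) → ℝ) (ν : L2 f) (g : Finset (Fin p) → L2 f) : ℝ :=
  ∫ x, ((∑ S, g S x) - ν x) ^ 2 ∂(muF f)

/-- `g` solves the constrained least-squares problem that defines the generalized functional ANOVA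
decomposition of `ν`. -/
def IsSolution {p : ℕ} (f : (Fin p → ℝ) → ℝ) (ν : L2 f) (g : Finset (Fin p) → L2 f) : Prop :=
  Feasible f g ∧ ∀ g', Feasible f g' → objective f ν g ≤ objective f ν g'

end FANOVA

end

open MeasureTheory FANOVA

noncomputable section

namespace FANOVA

/-! Let N_S be f_S divided by 2^{p-|S|}, the volume of the complementary cube. The Legendre tensor
products divided by √f form an orthonormal basis (e_i) of L² (`legendreBasis`), and ξ_i, for i = (S,
m_S), is a nonzero constant c_S times (√f / N_S) e_i. Hence Ξ is the image of (e_i) under A = ∑_S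
c_S D_S Π_S (`synthesisOp`), where Π_S projects onto the closed span of the e_i with index set S and
D_S multiplies by √f / N_S. The task is to invert A.

For functions of x_S the weight f may be replaced by N_S (`inner_eq_inner_mulOp`). This weight
cancels the denominator of D_S e_i, so hierarchical orthogonality becomes Lebesgue orthogonality of
Legendre products. As a result D_S carries the range of Π_S exactly onto V_S, the space of
hierarchically orthogonal functions of x_S (`dualOp_levelProj_mem`, `levelProj_dualOpInv`).

Lower bound: take g_T ∈ V_T. If S is contained in no other T of the sum, then g_S is orthogonal to
the other summands for the weight N_S. Since N_S / f lies in [c₁/c₂, c₂/c₁], the norm of g_S is at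
most c₂/c₁ times that of the whole sum (`norm_le_of_maximal`). Peeling off sets by decreasing
cardinality controls every component (`exists_norm_le_sum`), so A is bounded below: it is injective
with closed range.

Surjectivity: subtract from a function of x_S its projection onto the closed sum of the L²_T, T ⊊ S.
The remainder is in V_S, hence in the range of A, and the projection is in the range by induction
(`L2S_le_range`).

The coefficients of ν are then those of A⁻¹ν in (e_i), and its components are c_S D_S Π_S A⁻¹ν. They
sum to ν exactly, so the minimum of the objective is 0. -/

/-! ### Legendre polynomials: recurrence, orthogonality, degree -/

open Polynomial in
/-- The three-term recurrence, without division. -/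
theorem legendre_succ_succ (n : ℕ) :
    ((n : ℝ[X]) + 2) * legendre (n + 2) =
      (2 * (n : ℝ[X]) + 3) * X * legendre (n + 1) - ((n : ℝ[X]) + 1) * legendre n := by
  have h : ((n : ℝ[X]) + 2) * C (1 / ((n : ℝ) + 2)) = 1 := by
    have : ((n : ℝ[X]) + 2) = C ((n : ℝ) + 2) := by simp [map_ofNat]
    rw [this, ← C_mul, mul_one_div_cancel (by positivity), C_1]
  rw [legendre, ← mul_assoc, h, one_mul]
  simp [map_ofNat]

-- The two identities need each other: differentiating the recurrence gives the first at n + 1 once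
-- the second is known at n, and the second at n + 1 then follows algebraically.
open Polynomial in
theorem derivative_legendre (n : ℕ) :
    derivative (legendre (n + 1)) = X * derivative (legendre n) + ((n : ℝ[X]) + 1) * legendre n ∧
    X * derivative (legendre (n + 1)) - derivative (legendre n)
      = ((n : ℝ[X]) + 1) * legendre (n + 1) := by
  induction n with
  | zero => simp [legendre]
  | succ n ih =>
    obtain ⟨hA, hB⟩ := ih
    have hrec := legendre_succ_succ n
    have hd := congrArg derivative hrec
    simp only [derivative_mul, derivative_add, derivative_sub, derivative_natCast, derivative_X,
      derivative_ofNat, derivative_one] at hd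
    have hne : ((n : ℝ[X]) + 2) ≠ 0 := by
      have : ((n : ℝ[X]) + 2) = ((n + 2 : ℕ) : ℝ[X]) := by push_cast; ring
      rw [this]
      exact_mod_cast Nat.succ_ne_zero (n + 1)
    have h1 : derivative (legendre (n + 2)) = X * derivative (legendre (n + 1))
        + ((n : ℝ[X]) + 2) * legendre (n + 1) := by
      apply mul_left_cancel₀ hne
      linear_combination hd + ((n : ℝ[X]) + 1) * hB
    push_cast
    refine ⟨by linear_combination h1, ?_⟩
    linear_combination X * h1 - hrec + X * hB - hA

open Polynomial in
/-- The Legendre polynomial `P_{n+1}` is a multiple of the derivative of `P_{n+2} - P_n`. -/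
theorem derivative_legendre_sub (n : ℕ) :
    derivative (legendre (n + 2) - legendre n) = (2 * (n : ℝ[X]) + 3) * legendre (n + 1) := by
  have h1 := (derivative_legendre (n + 1)).1
  have h2 := (derivative_legendre n).2
  push_cast at h1
  rw [derivative_sub]
  linear_combination h1 + h2

theorem legendre_eval_one_and_neg_one (n : ℕ) :
    ((legendre n).eval 1 = 1 ∧ (legendre n).eval (-1) = (-1) ^ n) ∧
    ((legendre (n + 1)).eval 1 = 1 ∧ (legendre (n + 1)).eval (-1) = (-1) ^ (n + 1)) := by
  induction n with
  | zero => simp [legendre]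
  | succ n ih =>
    refine ⟨ih.2, ?_⟩
    obtain ⟨⟨h1, h2⟩, h3, h4⟩ := ih
    have hn : (n : ℝ) + 2 ≠ 0 := by positivity
    have r1 := congrArg (Polynomial.eval 1) (legendre_succ_succ n)
    have r2 := congrArg (Polynomial.eval (-1)) (legendre_succ_succ n)
    simp [h1, h2, h3, h4] at r1 r2
    constructor
    · apply mul_left_cancel₀ hn
      linear_combination r1
    · apply mul_left_cancel₀ hn
      rw [r2]; ring

/-- The integrand is a constant times the derivative of P_{n+2} - P_n, which vanishes at both
endpoints because the two indices have the same parity. -/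
theorem integral_legendre_succ (n : ℕ) : ∫ t in (-1 : ℝ)..1, (legendre (n + 1)).eval t = 0 := by
  have hd : ∀ t ∈ Set.uIcc (-1 : ℝ) 1, HasDerivAt (fun t => (legendre (n + 2) - legendre n).eval t)
      ((2 * (n : ℝ) + 3) * (legendre (n + 1)).eval t) t := by
    intro t _
    have := (legendre (n + 2) - legendre n).hasDerivAt t
    rw [derivative_legendre_sub] at this
    simpa using this
  have := intervalIntegral.integral_eq_sub_of_hasDerivAt hd
    (Continuous.intervalIntegrable (by fun_prop) _ _)
  have h0 := legendre_eval_one_and_neg_one n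
  have h2 := legendre_eval_one_and_neg_one (n + 1)
  rw [intervalIntegral.integral_const_mul] at this
  simp [h0.1.1, h0.1.2, h2.2.1, h2.2.2, pow_succ] at this
  rcases this with h | h
  · exact absurd h (by positivity)
  · exact h

/-- Orthogonality of the Legendre polynomials. -/
theorem integral_legendre_mul_legendre (m n : ℕ) :
    ∫ t in (-1 : ℝ)..1, (legendre m).eval t * (legendre n).eval t
      = if m = n then 2 / (2 * (n : ℝ) + 1) else 0 := by
  have hint : ∀ q : Polynomial ℝ, IntervalIntegrable (fun t => q.eval t) volume (-1) 1 :=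
    fun q => Continuous.intervalIntegrable (by fun_prop) _ _
  let E : Polynomial ℝ →ₗ[ℝ] ℝ :=
    { toFun := fun q => ∫ t in (-1 : ℝ)..1, q.eval t
      map_add' := fun a b => by
        simp only [Polynomial.eval_add]
        exact intervalIntegral.integral_add (hint a) (hint b)
      map_smul' := fun c a => by
        simp [Polynomial.eval_smul] }
  have hE : ∀ m n, ∫ t in (-1 : ℝ)..1, (legendre m).eval t * (legendre n).eval t
      = E (legendre m * legendre n) := fun m n => by simp [E]
  have hC : ∀ (k : ℕ) (q : Polynomial ℝ), E ((k : Polynomial ℝ) * q) = k * E q := fun k q => by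
    rw [← nsmul_eq_mul, map_nsmul, nsmul_eq_mul]
  have h0 : ∀ n, E (legendre 0 * legendre n) = if 0 = n then 2 / (2 * (n : ℝ) + 1) else 0 := by
    intro n
    cases n with
    | zero => simp [E, legendre]; norm_num
    | succ n => simpa [E, legendre] using integral_legendre_succ n
  -- At n = 0 the truncated index n - 1 is harmless, since its coefficient is n.
  have hX : ∀ n : ℕ, (2 * (n : Polynomial ℝ) + 1) * (Polynomial.X * legendre n)
      = ((n : Polynomial ℝ) + 1) * legendre (n + 1) + (n : Polynomial ℝ) * legendre (n - 1) := by
    intro n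
    cases n with
    | zero => simp [legendre]
    | succ n =>
      have := legendre_succ_succ n
      rw [Nat.add_sub_cancel]
      push_cast
      linear_combination -this
  -- Multiplication by X is symmetric: the integral of X P_m P_n is expanded by the recurrence in m
  -- and in n.
  have hsymm : ∀ m n : ℕ, (2 * (n : ℝ) + 1) * (((m : ℝ) + 1) * E (legendre (m + 1) * legendre n)
        + m * E (legendre (m - 1) * legendre n))
      = (2 * (m : ℝ) + 1) * (((n : ℝ) + 1) * E (legendre m * legendre (n + 1))
        + n * E (legendre m * legendre (n - 1))) := by
    intro m n
    have : ((2 * n + 1 : ℕ) : Polynomial ℝ) * (((m + 1 : ℕ) : Polynomial ℝ) *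
          (legendre (m + 1) * legendre n) + (m : Polynomial ℝ) * (legendre (m - 1) * legendre n))
        = ((2 * m + 1 : ℕ) : Polynomial ℝ) * (((n + 1 : ℕ) : Polynomial ℝ) *
          (legendre m * legendre (n + 1)) + (n : Polynomial ℝ) * (legendre m * legendre (n - 1))) := by
      push_cast
      linear_combination (2 * (m : Polynomial ℝ) + 1) * legendre m * hX n
        - (2 * (n : Polynomial ℝ) + 1) * legendre n * hX m
    have h := congrArg E this
    simp only [hC, map_add] at h
    push_cast at h
    exact h
  rw [hE]
  induction m using Nat.strong_induction_on generalizing n with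
  | _ m ih =>
    cases m with
    | zero => exact h0 n
    | succ m =>
      -- Solved for the entry (m + 1, n), the symmetry relation involves only entries whose first
      -- index is at most m.
      have h := hsymm m n
      rw [ih m (by omega) (n + 1), ih m (by omega) (n - 1)] at h
      have hpos : (0 : ℝ) < (2 * (n : ℝ) + 1) * ((m : ℝ) + 1) := by positivity
      apply mul_left_cancel₀ hpos.ne'
      have hm1 : (m : ℝ) * E (legendre (m - 1) * legendre n)
          = if m = n + 1 then (m : ℝ) * (2 / (2 * (n : ℝ) + 1)) else 0 := by
        cases m with
        | zero => simp
        | succ m =>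
          rw [Nat.add_sub_cancel, ih m (by omega) n]
          simp
      rw [mul_add, hm1] at h
      have h' : (2 * (n : ℝ) + 1) * ((m : ℝ) + 1) * E (legendre (m + 1) * legendre n) =
          (2 * (n : ℝ) + 1) * (((m : ℝ) + 1) * E (legendre (m + 1) * legendre n)) := by ring
      rw [h', eq_sub_of_add_eq h]
      by_cases h1 : m = n + 1
      · subst h1
        have : ¬ (n + 1 = n - 1) := by omega
        simp only [this, if_true, if_false]
        have : ¬ (n + 1 + 1 = n) := by omega
        simp only [this, if_false]
        push_cast
        field_simp
        ring
      · by_cases h2 : m + 1 = n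
        · subst h2
          simp only [h1, if_false, Nat.add_sub_cancel, if_true]
          push_cast
          field_simp
          ring
        · simp only [h1, h2, if_false]
          by_cases h3 : n = 0
          · simp [h3]
          · have : ¬ (m = n - 1) := by omega
            simp [this]

theorem integral_normLegendre_mul (m n : ℕ) :
    ∫ t in Set.Icc (-1 : ℝ) 1, normLegendre m t * normLegendre n t = if m = n then 1 else 0 := by
  rw [integral_Icc_eq_integral_Ioc, ← intervalIntegral.integral_of_le (by norm_num)]
  have : ∀ t, normLegendre m t * normLegendre n t
      = (Real.sqrt ((2 * (m : ℝ) + 1) / 2) * Real.sqrt ((2 * (n : ℝ) + 1) / 2)) *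
        ((legendre m).eval t * (legendre n).eval t) := fun t => by simp only [normLegendre]; ring
  simp only [this, intervalIntegral.integral_const_mul, integral_legendre_mul_legendre]
  split_ifs with h
  · subst h
    rw [Real.mul_self_sqrt (by positivity)]
    field_simp
  · simp

theorem normLegendre_zero (t : ℝ) : normLegendre 0 t = Real.sqrt (1 / 2) := by
  simp [normLegendre, legendre]

theorem integral_normLegendre {m : ℕ} (hm : m ≠ 0) :
    ∫ t in Set.Icc (-1 : ℝ) 1, normLegendre m t = 0 := by
  have h := integral_normLegendre_mul m 0
  simp only [normLegendre_zero, hm, if_false] at h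
  rw [integral_mul_const] at h
  rcases mul_eq_zero.1 h with h | h
  · exact h
  · exact absurd h (by positivity)

theorem continuous_normLegendre (m : ℕ) : Continuous (normLegendre m) := by
  unfold normLegendre
  fun_prop

/-- Having exactly one polynomial in each degree makes the sequence a basis of the polynomials,
which completeness uses. -/
theorem degree_legendre (n : ℕ) :
    (legendre n).degree = n ∧ (legendre (n + 1)).degree = ((n + 1 : ℕ) : WithBot ℕ) := by
  induction n with
  | zero => simp [legendre]
  | succ n ih =>
    refine ⟨ih.2, ?_⟩
    have h1 : (Polynomial.C (2 * (n : ℝ) + 3) * Polynomial.X * legendre (n + 1)).degree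
        = ((n + 2 : ℕ) : WithBot ℕ) := by
      rw [Polynomial.degree_mul, Polynomial.degree_mul, ih.2,
        Polynomial.degree_C (by positivity), Polynomial.degree_X]
      norm_cast
      ring
    rw [legendre, Polynomial.degree_mul, Polynomial.degree_C (by positivity), zero_add,
      Polynomial.degree_sub_eq_left_of_degree_lt, h1]
    rw [h1, Polynomial.degree_mul, ih.1, Polynomial.degree_C (by positivity), zero_add]
    exact_mod_cast (by omega : n < n + 2)

/-- The normalized Legendre polynomials as a polynomial sequence. -/
def normLegendreSeq : Polynomial.Sequence ℝ where
  elems' m := Polynomial.C (Real.sqrt ((2 * (m : ℝ) + 1) / 2)) * legendre m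
  degree_eq' m := by
    rw [Polynomial.degree_mul, Polynomial.degree_C (by positivity), zero_add, (degree_legendre m).1]

theorem eval_normLegendreSeq (m : ℕ) (t : ℝ) : (normLegendreSeq m).eval t = normLegendre m t := by
  simp [normLegendreSeq, normLegendre]

/-! ### Tensor products of Legendre polynomials on the cube -/

/-- Lebesgue measure on the cube `[-1,1]^ι`. -/
def cube (ι : Type*) [Fintype ι] : Measure (ι → ℝ) := volume.restrict (Set.Icc (-1) 1)

theorem cube_eq_pi (ι : Type*) [Fintype ι] :
    cube ι = Measure.pi (fun _ : ι => (volume : Measure ℝ).restrict (Set.Icc (-1) 1)) := by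
  rw [← Measure.restrict_pi_pi, Set.pi_univ_Icc]
  rfl

theorem ae_mem_cube (ι : Type*) [Fintype ι] : ∀ᵐ x ∂(cube ι), x ∈ Set.Icc (-1 : ι → ℝ) 1 :=
  ae_restrict_mem measurableSet_Icc

instance (ι : Type*) [Fintype ι] : IsFiniteMeasure (cube ι) := by
  rw [cube_eq_pi]
  infer_instance

theorem cube_real_univ (ι : Type*) [Fintype ι] :
    (cube ι).real Set.univ = 2 ^ Fintype.card ι := by
  rw [cube, measureReal_restrict_apply_univ, measureReal_def, Real.volume_Icc_pi_toReal]
  · norm_num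
  · intro i
    norm_num

/-- The tensor product of normalized Legendre polynomials. -/
def tensor {ι : Type*} [Fintype ι] (k : ι → ℕ) (x : ι → ℝ) : ℝ :=
  ∏ j, normLegendre (k j) (x j)

theorem continuous_tensor {ι : Type*} [Fintype ι] (k : ι → ℕ) : Continuous (tensor k) :=
  continuous_finsetProd _ fun j _ => (continuous_normLegendre (k j)).comp (continuous_apply j)

theorem exists_bound_on_cube {ι : Type*} [Fintype ι] {g : (ι → ℝ) → ℝ} (hg : Continuous g) :
    ∃ C, ∀ x ∈ Set.Icc (-1 : ι → ℝ) 1, ‖g x‖ ≤ C :=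
  isCompact_Icc.exists_bound_of_continuousOn hg.continuousOn

theorem integral_tensor_mul {ι : Type*} [Fintype ι] (k l : ι → ℕ) :
    ∫ x, tensor k x * tensor l x ∂(cube ι) = if k = l then 1 else 0 := by
  classical
  simp only [tensor, ← Finset.prod_mul_distrib]
  rw [cube_eq_pi,
    integral_fintype_prod_eq_prod (fun j t => normLegendre (k j) t * normLegendre (l j) t)]
  simp only [integral_normLegendre_mul]
  split_ifs with h
  · subst h
    simp
  · obtain ⟨j, hj⟩ := Function.ne_iff.1 h
    exact Finset.prod_eq_zero (Finset.mem_univ j) (by simp [hj])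

theorem integral_tensor_eq_zero {ι : Type*} [Fintype ι] {k : ι → ℕ} {j : ι} (hj : k j ≠ 0) :
    ∫ x, tensor k x ∂(cube ι) = 0 := by
  simp only [tensor]
  rw [cube_eq_pi, integral_fintype_prod_eq_prod (fun j t => normLegendre (k j) t)]
  exact Finset.prod_eq_zero (Finset.mem_univ j) (integral_normLegendre hj)

/-! ### Splitting the coordinates into S and its complement -/

/-- Splitting the coordinates of the cube. -/
abbrev splitEquiv {p : ℕ} (S : Finset (Fin p)) :
    (Fin p → ℝ) ≃ᵐ ({j // j ∈ S} → ℝ) × ({j // ¬ j ∈ S} → ℝ) :=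
  MeasurableEquiv.piEquivPiSubtypeProd (fun _ : Fin p => ℝ) (fun j => j ∈ S)

theorem measurePreserving_splitEquiv {p : ℕ} (S : Finset (Fin p)) :
    MeasurePreserving (splitEquiv S) (cube (Fin p)) ((cube {j // j ∈ S}).prod (cube {j // ¬ j ∈ S})) := by
  rw [cube_eq_pi, cube_eq_pi, cube_eq_pi]
  convert measurePreserving_piEquivPiSubtypeProd
    (fun _ : Fin p => (volume : Measure ℝ).restrict (Set.Icc (-1) 1)) (fun j => j ∈ S)

theorem integral_cube_split {p : ℕ} (S : Finset (Fin p)) (F : (Fin p → ℝ) → ℝ) :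
    ∫ x, F x ∂(cube (Fin p))
      = ∫ z, F ((splitEquiv S).symm z) ∂((cube {j // j ∈ S}).prod (cube {j // ¬ j ∈ S})) :=
  (((measurePreserving_splitEquiv S).symm _).integral_comp' F).symm

theorem restrict_splitEquiv_symm {p : ℕ} (S : Finset (Fin p))
    (z : ({j // j ∈ S} → ℝ) × ({j // ¬ j ∈ S} → ℝ)) : S.restrict ((splitEquiv S).symm z) = z.1 :=
  congrArg Prod.fst ((splitEquiv S).apply_symm_apply z)

theorem restrict_compl_splitEquiv_symm {p : ℕ} (S : Finset (Fin p))
    (z : ({j // j ∈ S} → ℝ) × ({j // ¬ j ∈ S} → ℝ)) (j : {j // ¬ j ∈ S}) :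
    (splitEquiv S).symm z j = z.2 j :=
  congrFun (congrArg Prod.snd ((splitEquiv S).apply_symm_apply z)) j

theorem splitEquiv_symm_mem {p : ℕ} {S : Finset (Fin p)}
    {z : ({j // j ∈ S} → ℝ) × ({j // ¬ j ∈ S} → ℝ)} (h1 : z.1 ∈ Set.Icc (-1 : _ → ℝ) 1)
    (h2 : z.2 ∈ Set.Icc (-1 : _ → ℝ) 1) :
    (splitEquiv S).symm z ∈ Set.Icc (-1 : Fin p → ℝ) 1 := by
  have key : ∀ j, (splitEquiv S).symm z j ∈ Set.Icc (-1 : ℝ) 1 := by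
    intro j
    by_cases hj : j ∈ S
    · have := congrFun (restrict_splitEquiv_symm S z) ⟨j, hj⟩
      rw [Finset.restrict] at this
      simp only at this
      rw [this]
      exact ⟨h1.1 _, h1.2 _⟩
    · rw [restrict_compl_splitEquiv_symm S z ⟨j, hj⟩]
      exact ⟨h2.1 _, h2.2 _⟩
  exact ⟨fun j => (key j).1, fun j => (key j).2⟩

/-- A tensor product with a nonconstant factor in a coordinate outside `S` is orthogonal to every
function of `x_S`. -/
theorem integral_tensor_mul_restrict {p : ℕ} {S : Finset (Fin p)} {k : Fin p → ℕ} {j : Fin p}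
    (hj : j ∉ S) (hk : k j ≠ 0) (h : ({j // j ∈ S} → ℝ) → ℝ) :
    ∫ x, tensor k x * h (S.restrict x) ∂(cube (Fin p)) = 0 := by
  rw [integral_cube_split S]
  have : ∀ z : ({j // j ∈ S} → ℝ) × ({j // ¬ j ∈ S} → ℝ),
      tensor k ((splitEquiv S).symm z) * h (S.restrict ((splitEquiv S).symm z))
        = (tensor (fun j : {j // j ∈ S} => k j) z.1 * h z.1)
          * tensor (fun j : {j // ¬ j ∈ S} => k j) z.2 := by
    intro z
    rw [restrict_splitEquiv_symm, tensor, ← Fintype.prod_subtype_mul_prod_subtype (fun j => j ∈ S)]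
    simp only [restrict_compl_splitEquiv_symm]
    have h1 : ∀ j : {j // j ∈ S}, (splitEquiv S).symm z j = z.1 j :=
      fun j => congrFun (restrict_splitEquiv_symm S z) j
    simp only [h1, tensor]
    convert mul_right_comm _ _ _
  simp only [this]
  rw [integral_prod_mul (fun a => tensor (fun j : {j // j ∈ S} => k j) a * h a),
    integral_tensor_eq_zero (ι := {j // ¬ j ∈ S}) (j := ⟨j, hj⟩) hk, mul_zero]

/-! ### Averaged marginal densities -/

/-- The average of `f` over the coordinates outside `S`. -/
def avgMarginal {p : ℕ} (f : (Fin p → ℝ) → ℝ) (S : Finset (Fin p)) (xS : {j // j ∈ S} → ℝ) : ℝ :=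
  marginal f S xS / 2 ^ (p - S.card)

theorem measurable_marginal {p : ℕ} {f : (Fin p → ℝ) → ℝ} (hf : Measurable f)
    (S : Finset (Fin p)) : Measurable (marginal f S) := by
  have : StronglyMeasurable (fun z => f ((splitEquiv S).symm z)) :=
    (hf.comp (splitEquiv S).symm.measurable).stronglyMeasurable
  exact this.integral_prod_right.measurable

theorem measurable_avgMarginal {p : ℕ} {f : (Fin p → ℝ) → ℝ} (hf : Measurable f)
    (S : Finset (Fin p)) : Measurable (avgMarginal f S) :=
  (measurable_marginal hf S).div_const _

theorem card_compl_subtype {p : ℕ} (S : Finset (Fin p)) :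
    Fintype.card {j // ¬ j ∈ S} = p - S.card := by
  rw [Fintype.card_subtype_compl, Fintype.card_fin, Fintype.card_coe]

/-- An average of f over the complementary cube, rather than an integral, inherits the bounds of f
with the same constants for every S. -/
theorem avgMarginal_bounds {p : ℕ} {f : (Fin p → ℝ) → ℝ} (hf : Measurable f) {c₁ c₂ : ℝ}
    (hbound : ∀ x ∈ Set.Icc (-1 : Fin p → ℝ) 1, c₁ ≤ f x ∧ f x ≤ c₂) (S : Finset (Fin p))
    {a : {j // j ∈ S} → ℝ} (ha : a ∈ Set.Icc (-1 : _ → ℝ) 1) :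
    c₁ ≤ avgMarginal f S a ∧ avgMarginal f S a ≤ c₂ := by
  have hmem : ∀ᵐ y ∂(cube {j // ¬ j ∈ S}),
      c₁ ≤ f ((splitEquiv S).symm (a, y)) ∧ f ((splitEquiv S).symm (a, y)) ≤ c₂ := by
    filter_upwards [ae_mem_cube _] with y hy
    exact hbound _ (splitEquiv_symm_mem ha hy)
  have hint : Integrable (fun y => f ((splitEquiv S).symm (a, y))) (cube {j // ¬ j ∈ S}) := by
    refine Integrable.of_bound (C := max |c₁| |c₂|) ?_ ?_
    · exact (hf.comp ((splitEquiv S).symm.measurable.comp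
        measurable_prodMk_left)).aestronglyMeasurable
    · filter_upwards [hmem] with y hy
      exact abs_le_max_abs_abs hy.1 hy.2
  have hconst : ∀ c : ℝ, ∫ _, c ∂(cube {j // ¬ j ∈ S}) = c * 2 ^ (p - S.card) := by
    intro c
    rw [integral_const, cube_real_univ, card_compl_subtype, smul_eq_mul, mul_comm]
  have hm : marginal f S a = ∫ y, f ((splitEquiv S).symm (a, y)) ∂(cube {j // ¬ j ∈ S}) := rfl
  rw [avgMarginal, le_div_iff₀ (by positivity), div_le_iff₀ (by positivity), hm, ← hconst,
    ← hconst]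
  exact ⟨integral_mono_ae (integrable_const _) hint (hmem.mono fun _ h => h.1),
    integral_mono_ae hint (integrable_const _) (hmem.mono fun _ h => h.2)⟩

/-- Integrating a function of `x_S` against `f` only sees the marginal of `f`. -/
theorem integral_restrict_mul_density {p : ℕ} {f : (Fin p → ℝ) → ℝ} (hf : Measurable f) {c₁ c₂ : ℝ}
    (hbound : ∀ x ∈ Set.Icc (-1 : Fin p → ℝ) 1, c₁ ≤ f x ∧ f x ≤ c₂) (S : Finset (Fin p))
    {h : ({j // j ∈ S} → ℝ) → ℝ} (hh : Integrable (fun x => h (S.restrict x)) (cube (Fin p))) :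
    ∫ x, h (S.restrict x) * f x ∂(cube (Fin p))
      = ∫ x, h (S.restrict x) * avgMarginal f S (S.restrict x) ∂(cube (Fin p)) := by
  have hint : Integrable (fun x => h (S.restrict x) * f x) (cube (Fin p)) := by
    refine hh.mul_bdd (c := max |c₁| |c₂|) hf.aestronglyMeasurable ?_
    filter_upwards [ae_mem_cube _] with x hx
    exact abs_le_max_abs_abs (hbound x hx).1 (hbound x hx).2
  have hint' : Integrable (fun z => h (S.restrict ((splitEquiv S).symm z)) *
      f ((splitEquiv S).symm z)) ((cube {j // j ∈ S}).prod (cube {j // ¬ j ∈ S})) :=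
    ((measurePreserving_splitEquiv S).symm _).integrable_comp_of_integrable hint
  rw [integral_cube_split S, integral_cube_split S]
  have e2 : ∀ z : ({j // j ∈ S} → ℝ) × ({j // ¬ j ∈ S} → ℝ),
      h (S.restrict ((splitEquiv S).symm z)) * avgMarginal f S (S.restrict ((splitEquiv S).symm z))
      = (h z.1 * avgMarginal f S z.1) * 1 := fun z => by rw [restrict_splitEquiv_symm, mul_one]
  simp only [e2]
  rw [integral_prod_mul (fun a => h a * avgMarginal f S a) (fun _ => (1 : ℝ)), integral_const,
    cube_real_univ, card_compl_subtype, integral_prod _ hint', ← integral_mul_const]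
  refine integral_congr_ae (Filter.Eventually.of_forall fun a => ?_)
  simp only [restrict_splitEquiv_symm]
  rw [integral_const_mul]
  have hm : marginal f S a = ∫ y, f ((splitEquiv S).symm (a, y)) ∂(cube {j // ¬ j ∈ S}) := rfl
  rw [← hm, avgMarginal]
  field_simp
  simp

/-! ### Completeness of the Legendre tensor products -/

theorem integrable_mul_continuous {ι : Type*} [Fintype ι] {u : (ι → ℝ) → ℝ}
    (hu : Integrable u (cube ι)) {g : (ι → ℝ) → ℝ} (hg : Continuous g) :
    Integrable (fun x => u x * g x) (cube ι) := by
  obtain ⟨C, hC⟩ := exists_bound_on_cube hg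
  exact hu.mul_bdd (c := C) hg.aestronglyMeasurable ((ae_mem_cube ι).mono hC)

/-- An integrable function on the cube whose integrals against all Legendre tensor products vanish
has vanishing integrals against all polynomials. -/
theorem integral_mul_mvPolynomial_eq_zero {ι : Type*} [Fintype ι] {u : (ι → ℝ) → ℝ}
    (hu : Integrable u (cube ι)) (h : ∀ k, ∫ x, u x * tensor k x ∂(cube ι) = 0)
    (q : MvPolynomial ι ℝ) : ∫ x, u x * MvPolynomial.eval x q ∂(cube ι) = 0 := by
  have hint : ∀ q : MvPolynomial ι ℝ, Integrable (fun x => u x * MvPolynomial.eval x q) (cube ι) :=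
    fun q => integrable_mul_continuous hu (MvPolynomial.continuous_eval q)
  let Λ : MvPolynomial ι ℝ →ₗ[ℝ] ℝ :=
    { toFun := fun q => ∫ x, u x * MvPolynomial.eval x q ∂(cube ι)
      map_add' := fun a b => by
        simp only [map_add, mul_add]
        exact integral_add (hint a) (hint b)
      map_smul' := fun c a => by
        simp only [MvPolynomial.smul_eval, RingHom.id_apply, smul_eq_mul]
        rw [← integral_const_mul]
        congr 1
        ext x
        ring }
  -- The map (q_j) ↦ Λ(∏ q_j(X_j)). Multilinearity lets the basis be changed in each variable
  -- separately: it vanishes on Legendre polynomials, hence on powers, and these give all monomials.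
  let m : MultilinearMap ℝ (fun _ : ι => Polynomial ℝ) ℝ :=
    Λ.compMultilinearMap ((MultilinearMap.mkPiAlgebra ℝ ι (MvPolynomial ι ℝ)).compLinearMap
      (fun j => (Polynomial.aeval (MvPolynomial.X j : MvPolynomial ι ℝ)).toLinearMap))
  have hev : ∀ (x : ι → ℝ) (j : ι) (q : Polynomial ℝ),
      MvPolynomial.eval x (Polynomial.aeval (MvPolynomial.X j) q) = q.eval (x j) := by
    intro x j q
    have : (MvPolynomial.aeval x).comp (Polynomial.aeval (MvPolynomial.X j : MvPolynomial ι ℝ))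
        = Polynomial.aeval (x j) := by
      ext
      simp
    simpa [MvPolynomial.aeval_eq_eval] using congrArg (fun l : Polynomial ℝ →ₐ[ℝ] ℝ => l q) this
  have hm : m = 0 := by
    refine Module.Basis.ext_multilinear (fun _ => normLegendreSeq.basis fun i =>
      (Polynomial.leadingCoeff_ne_zero.2 (normLegendreSeq.ne_zero i)).isUnit) fun k => ?_
    have := h k
    simp only [tensor] at this
    simpa [m, Λ, MvPolynomial.eval_prod, ← eval_normLegendreSeq, hev] using this
  have hΛ : Λ = 0 := by
    refine (MvPolynomial.basisMonomials ι ℝ).ext fun s => ?_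
    have := congrArg (fun m : MultilinearMap ℝ (fun _ : ι => Polynomial ℝ) ℝ =>
      m (fun j => Polynomial.X ^ s j)) hm
    simp only [m, LinearMap.compMultilinearMap_apply, MultilinearMap.compLinearMap_apply,
      MultilinearMap.mkPiAlgebra_apply, AlgHom.toLinearMap_apply, map_pow, Polynomial.aeval_X,
      zero_apply] at this
    rw [MvPolynomial.coe_basisMonomials, LinearMap.zero_apply]
    beta_reduce
    rw [MvPolynomial.monomial_eq, Finsupp.prod_fintype _ _ (by simp)]
    simpa using this
  exact congrArg (fun l : MvPolynomial ι ℝ →ₗ[ℝ] ℝ => l q) hΛ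

/-- Weierstrass approximation on the cube. -/
theorem exists_mvPolynomial_near {ι : Type*} [Fintype ι] {g : (ι → ℝ) → ℝ} (hg : Continuous g)
    {ε : ℝ} (hε : 0 < ε) :
    ∃ q : MvPolynomial ι ℝ, ∀ x ∈ Set.Icc (-1 : ι → ℝ) 1, ‖MvPolynomial.eval x q - g x‖ < ε := by
  let K := Set.Icc (-1 : ι → ℝ) 1
  have : CompactSpace K := isCompact_iff_compactSpace.1 isCompact_Icc
  let coord : ι → C(K, ℝ) := fun j => ⟨fun x => x.1 j, (continuous_apply j).comp continuous_subtype_val⟩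
  let A : Subalgebra ℝ C(K, ℝ) := (MvPolynomial.aeval coord).range
  have hA : A.SeparatesPoints := by
    intro x y hxy
    obtain ⟨j, hj⟩ : ∃ j, x.1 j ≠ y.1 j := Function.ne_iff.1 fun h => hxy (Subtype.ext h)
    exact ⟨coord j, ⟨coord j, ⟨MvPolynomial.X j, by simp⟩, rfl⟩, hj⟩
  obtain ⟨⟨a, q, rfl⟩, hq⟩ := ContinuousMap.exists_mem_subalgebra_near_continuous_of_separatesPoints
    A hA (fun x => g x.1) (hg.comp continuous_subtype_val) ε hε
  refine ⟨q, fun x hx => ?_⟩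
  have h1 := hq ⟨x, hx⟩
  have h2 : (MvPolynomial.aeval coord q) ⟨x, hx⟩ = MvPolynomial.eval x q := by
    have : ((ContinuousMap.evalAlgHom ℝ ℝ (⟨x, hx⟩ : K)).comp (MvPolynomial.aeval coord))
        = MvPolynomial.aeval x := by
      ext j
      simp [coord]
    have := congrArg (fun l : MvPolynomial ι ℝ →ₐ[ℝ] ℝ => l q) this
    simpa [MvPolynomial.aeval_eq_eval] using this
  simpa [h2] using h1

/-- Completeness of the Legendre tensor products. -/
theorem ae_eq_zero_of_integral_tensor_eq_zero {ι : Type*} [Fintype ι] {u : (ι → ℝ) → ℝ}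
    (hu : Integrable u (cube ι)) (h : ∀ k, ∫ x, u x * tensor k x ∂(cube ι) = 0) :
    ∀ᵐ x ∂(cube ι), u x = 0 := by
  refine ae_eq_zero_of_integral_contDiff_smul_eq_zero hu.locallyIntegrable fun g hg _ => ?_
  simp only [smul_eq_mul, mul_comm (g _)]
  have hgc := hg.continuous
  by_contra hne
  have hpos : 0 < ‖∫ x, u x * g x ∂(cube ι)‖ := norm_pos_iff.2 hne
  set I := ‖∫ x, u x * g x ∂(cube ι)‖
  have hU : 0 ≤ ∫ x, ‖u x‖ ∂(cube ι) := integral_nonneg fun _ => norm_nonneg _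
  -- With error I / (‖u‖₁ + 1) the bound becomes I ≤ ‖u‖₁ I / (‖u‖₁ + 1), impossible for I > 0; the
  -- + 1 also covers ‖u‖₁ = 0.
  obtain ⟨q, hq⟩ := exists_mvPolynomial_near hgc
    (div_pos hpos (by linarith : 0 < (∫ x, ‖u x‖ ∂(cube ι)) + 1))
  have hqc : Continuous fun x => MvPolynomial.eval x q := MvPolynomial.continuous_eval q
  have h1 : ∫ x, u x * g x ∂(cube ι) = ∫ x, u x * (g x - MvPolynomial.eval x q) ∂(cube ι) := by
    simp only [mul_sub]
    rw [integral_sub (integrable_mul_continuous hu hgc) (integrable_mul_continuous hu hqc),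
      integral_mul_mvPolynomial_eq_zero hu h, sub_zero]
  have h2 : I ≤ (∫ x, ‖u x‖ ∂(cube ι)) * (I / ((∫ x, ‖u x‖ ∂(cube ι)) + 1)) := by
    simp only [I]
    nth_rewrite 1 [h1]
    rw [← integral_mul_const]
    refine norm_integral_le_of_norm_le (hu.norm.mul_const _) ?_
    filter_upwards [ae_mem_cube ι] with x hx
    rw [norm_mul, norm_sub_rev]
    exact mul_le_mul_of_nonneg_left (hq x hx).le (norm_nonneg _)
  rw [mul_div_assoc', le_div_iff₀ (by linarith)] at h2
  linarith

/-! ### Bounded densities and multiplication operators -/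

/-- A measurable density on the cube that is bounded away from zero and infinity. -/
structure IsBoundedDensity {p : ℕ} (f : (Fin p → ℝ) → ℝ) (c₁ c₂ : ℝ) : Prop where
  pos : 0 < c₁
  meas : Measurable f
  bound : ∀ x ∈ Set.Icc (-1 : Fin p → ℝ) 1, c₁ ≤ f x ∧ f x ≤ c₂

/-- Functions that are measurable and bounded on the cube. -/
def IsMultiplier {p : ℕ} (w : (Fin p → ℝ) → ℝ) : Prop :=
  Measurable w ∧ ∃ C, ∀ x ∈ Set.Icc (-1 : Fin p → ℝ) 1, ‖w x‖ ≤ C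

theorem IsMultiplier.mul {p : ℕ} {w v : (Fin p → ℝ) → ℝ} (hw : IsMultiplier w)
    (hv : IsMultiplier v) : IsMultiplier (fun x => w x * v x) := by
  obtain ⟨hw, C, hC⟩ := hw
  obtain ⟨hv, D, hD⟩ := hv
  refine ⟨hw.mul hv, C * D, fun x hx => ?_⟩
  rw [norm_mul]
  exact mul_le_mul (hC x hx) (hD x hx) (norm_nonneg _) ((norm_nonneg _).trans (hC x hx))

theorem IsMultiplier.inv {p : ℕ} {w : (Fin p → ℝ) → ℝ} (hw : Measurable w) {c : ℝ} (hc : 0 < c)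
    (h : ∀ x ∈ Set.Icc (-1 : Fin p → ℝ) 1, c ≤ w x) : IsMultiplier (fun x => (w x)⁻¹) := by
  refine ⟨hw.inv, c⁻¹, fun x hx => ?_⟩
  rw [norm_inv, Real.norm_of_nonneg (hc.le.trans (h x hx))]
  exact inv_anti₀ hc (h x hx)

theorem IsMultiplier.of_continuous {p : ℕ} {w : (Fin p → ℝ) → ℝ} (hw : Continuous w) :
    IsMultiplier w := ⟨hw.measurable, exists_bound_on_cube hw⟩

theorem ae_muF_mem_cube {p : ℕ} (f : (Fin p → ℝ) → ℝ) :
    ∀ᵐ x ∂(muF f), x ∈ Set.Icc (-1 : Fin p → ℝ) 1 :=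
  (withDensity_absolutelyContinuous _ _).ae_le (ae_mem_cube (Fin p))

theorem IsMultiplier.memLp {p : ℕ} {f w : (Fin p → ℝ) → ℝ} (hw : IsMultiplier w) :
    MemLp w ⊤ (muF f) := by
  obtain ⟨hw, C, hC⟩ := hw
  exact memLp_top_of_bound hw.aestronglyMeasurable C ((ae_muF_mem_cube f).mono hC)

open scoped Classical in
/-- Multiplication by a bounded function, as an operator on `L²` (zero if the function is not
essentially bounded). -/
def mulOp {p : ℕ} (f w : (Fin p → ℝ) → ℝ) : L2 f →L[ℝ] L2 f :=
  if h : MemLp w ⊤ (muF f) then (ContinuousLinearMap.mul ℝ ℝ).holderL (muF f) ⊤ 2 2 (h.toLp w)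
  else 0

theorem coeFn_mulOp {p : ℕ} {f w : (Fin p → ℝ) → ℝ} (hw : IsMultiplier w) (g : L2 f) :
    ∀ᵐ x ∂(muF f), mulOp f w g x = w x * g x := by
  rw [mulOp, dif_pos hw.memLp]
  filter_upwards [(ContinuousLinearMap.mul ℝ ℝ).coeFn_holder (r := 2) (hw.memLp.toLp w) g,
    hw.memLp.coeFn_toLp (f := w) (μ := muF f)] with x h1 h2
  rw [h2] at h1
  exact h1

theorem mulOp_mulOp {p : ℕ} {f w v u : (Fin p → ℝ) → ℝ} (hw : IsMultiplier w) (hv : IsMultiplier v)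
    (hu : IsMultiplier u) (h : ∀ x ∈ Set.Icc (-1 : Fin p → ℝ) 1, w x * v x = u x) (g : L2 f) :
    mulOp f w (mulOp f v g) = mulOp f u g := by
  apply Lp.ext
  filter_upwards [coeFn_mulOp hw (mulOp f v g), coeFn_mulOp hv g, coeFn_mulOp hu g,
    ae_muF_mem_cube f] with x h1 h2 h3 hx
  rw [h1, h2, h3, ← h x hx, mul_assoc]

theorem mulOp_one {p : ℕ} (f : (Fin p → ℝ) → ℝ) (g : L2 f) : mulOp f (fun _ => 1) g = g := by
  apply Lp.ext
  filter_upwards [coeFn_mulOp (.of_continuous continuous_const) g] with x h1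
  rw [h1, one_mul]

theorem inner_eq_integral {p : ℕ} {f : (Fin p → ℝ) → ℝ} (g h : L2 f) :
    inner ℝ g h = ∫ x, g x * h x ∂(muF f) := by
  rw [L2.inner_def]
  simp [mul_comm]

theorem integrable_mul {p : ℕ} {f : (Fin p → ℝ) → ℝ} (g h : L2 f) :
    Integrable (fun x => g x * h x) (muF f) :=
  (Lp.memLp g).integrable_mul (Lp.memLp h)

theorem inner_mulOp {p : ℕ} {f w : (Fin p → ℝ) → ℝ} (hw : IsMultiplier w) (g h : L2 f) :
    inner ℝ (mulOp f w g) h = inner ℝ g (mulOp f w h) := by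
  rw [inner_eq_integral, inner_eq_integral]
  refine integral_congr_ae ?_
  filter_upwards [coeFn_mulOp hw g, coeFn_mulOp hw h] with x h1 h2
  rw [h1, h2]
  ring

theorem inner_mulOp_self_le {p : ℕ} {f w : (Fin p → ℝ) → ℝ} (hw : IsMultiplier w) {C : ℝ}
    (hC : ∀ x ∈ Set.Icc (-1 : Fin p → ℝ) 1, w x ≤ C) (g : L2 f) :
    inner ℝ g (mulOp f w g) ≤ C * ‖g‖ ^ 2 := by
  rw [← real_inner_self_eq_norm_sq, inner_eq_integral, inner_eq_integral, ← integral_const_mul]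
  refine integral_mono_ae (integrable_mul _ _) ((integrable_mul _ _).const_mul _) ?_
  filter_upwards [coeFn_mulOp hw g, ae_muF_mem_cube f] with x h1 hx
  rw [h1]
  nlinarith [mul_le_mul_of_nonneg_right (hC x hx) (mul_self_nonneg (g x))]

theorem le_inner_mulOp_self {p : ℕ} {f w : (Fin p → ℝ) → ℝ} (hw : IsMultiplier w) {c : ℝ}
    (hc : ∀ x ∈ Set.Icc (-1 : Fin p → ℝ) 1, c ≤ w x) (g : L2 f) :
    c * ‖g‖ ^ 2 ≤ inner ℝ g (mulOp f w g) := by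
  rw [← real_inner_self_eq_norm_sq, inner_eq_integral, inner_eq_integral, ← integral_const_mul]
  refine integral_mono_ae ((integrable_mul _ _).const_mul _) (integrable_mul _ _) ?_
  filter_upwards [coeFn_mulOp hw g, ae_muF_mem_cube f] with x h1 hx
  rw [h1]
  nlinarith [mul_le_mul_of_nonneg_right (hc x hx) (mul_self_nonneg (g x))]

namespace IsBoundedDensity

variable {p : ℕ} {f : (Fin p → ℝ) → ℝ} {c₁ c₂ : ℝ}

theorem pos_of_mem (H : IsBoundedDensity f c₁ c₂) {x : Fin p → ℝ}
    (hx : x ∈ Set.Icc (-1 : Fin p → ℝ) 1) : 0 < f x := H.pos.trans_le (H.bound x hx).1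

theorem le (H : IsBoundedDensity f c₁ c₂) : c₁ ≤ c₂ := by
  have h : (0 : Fin p → ℝ) ∈ Set.Icc (-1 : Fin p → ℝ) 1 := ⟨fun _ => by simp, fun _ => by simp⟩
  exact (H.bound 0 h).1.trans (H.bound 0 h).2

/-- As f > 0 on the cube, Lebesgue measure there is absolutely continuous with respect to μ_f. -/
theorem ae_cube (H : IsBoundedDensity f c₁ c₂) {P : (Fin p → ℝ) → Prop}
    (h : ∀ᵐ x ∂(muF f), P x) : ∀ᵐ x ∂(cube (Fin p)), P x := by
  refine (withDensity_absolutelyContinuous' (μ := cube (Fin p))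
    H.meas.ennreal_ofReal.aemeasurable ?_).ae_le h
  filter_upwards [ae_mem_cube (Fin p)] with x hx
  simpa using H.pos_of_mem hx

theorem integral_muF (H : IsBoundedDensity f c₁ c₂) (g : (Fin p → ℝ) → ℝ) :
    ∫ x, g x ∂(muF f) = ∫ x, g x * f x ∂(cube (Fin p)) := by
  rw [muF, integral_withDensity_eq_integral_toReal_smul H.meas.ennreal_ofReal (by simp)]
  refine integral_congr_ae ?_
  filter_upwards [ae_mem_cube (Fin p)] with x hx
  rw [ENNReal.toReal_ofReal (H.pos_of_mem hx).le, smul_eq_mul, mul_comm]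

theorem isFiniteMeasure (H : IsBoundedDensity f c₁ c₂) : IsFiniteMeasure (muF f) := by
  refine isFiniteMeasure_withDensity (μ := cube (Fin p)) (ne_of_lt ?_)
  have : ∫⁻ x, ENNReal.ofReal (f x) ∂(cube (Fin p)) ≤ ∫⁻ _, ENNReal.ofReal c₂ ∂(cube (Fin p)) := by
    refine lintegral_mono_ae ?_
    filter_upwards [ae_mem_cube (Fin p)] with x hx
    exact ENNReal.ofReal_le_ofReal (H.bound x hx).2
  refine this.trans_lt ?_
  rw [lintegral_const]
  exact ENNReal.mul_lt_top ENNReal.ofReal_lt_top (measure_lt_top _ _)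

theorem isMultiplier_inv (H : IsBoundedDensity f c₁ c₂) : IsMultiplier (fun x => (f x)⁻¹) :=
  IsMultiplier.inv H.meas H.pos fun x hx => (H.bound x hx).1

theorem isMultiplier_sqrt (H : IsBoundedDensity f c₁ c₂) :
    IsMultiplier (fun x => Real.sqrt (f x)) := by
  refine ⟨H.meas.sqrt, Real.sqrt c₂, fun x hx => ?_⟩
  rw [Real.norm_of_nonneg (Real.sqrt_nonneg _)]
  exact Real.sqrt_le_sqrt (H.bound x hx).2

theorem isMultiplier_inv_sqrt (H : IsBoundedDensity f c₁ c₂) :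
    IsMultiplier (fun x => (Real.sqrt (f x))⁻¹) :=
  IsMultiplier.inv H.meas.sqrt (Real.sqrt_pos.2 H.pos) fun x hx =>
    Real.sqrt_le_sqrt (H.bound x hx).1

theorem integrable_cube (H : IsBoundedDensity f c₁ c₂) {g : (Fin p → ℝ) → ℝ}
    (hg : Integrable g (muF f)) : Integrable g (cube (Fin p)) := by
  rw [muF, integrable_withDensity_iff H.meas.ennreal_ofReal (by simp)] at hg
  obtain ⟨hm, C, hC⟩ := H.isMultiplier_inv
  refine (hg.mul_bdd (c := C) (g := fun x => (f x)⁻¹) hm.aestronglyMeasurable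
    ((ae_mem_cube _).mono hC)).congr ?_
  filter_upwards [ae_mem_cube (Fin p)] with x hx
  have := H.pos_of_mem hx
  rw [ENNReal.toReal_ofReal this.le]
  field_simp

theorem restrict_mem (S : Finset (Fin p)) {x : Fin p → ℝ} (hx : x ∈ Set.Icc (-1 : Fin p → ℝ) 1) :
    S.restrict x ∈ Set.Icc (-1 : {j // j ∈ S} → ℝ) 1 :=
  ⟨fun j => hx.1 j, fun j => hx.2 j⟩

theorem avgMarginal_bound (H : IsBoundedDensity f c₁ c₂) (S : Finset (Fin p)) {x : Fin p → ℝ}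
    (hx : x ∈ Set.Icc (-1 : Fin p → ℝ) 1) :
    c₁ ≤ avgMarginal f S (S.restrict x) ∧ avgMarginal f S (S.restrict x) ≤ c₂ :=
  avgMarginal_bounds H.meas H.bound S (restrict_mem S hx)

theorem measurable_avgMarginal_restrict (H : IsBoundedDensity f c₁ c₂) (S : Finset (Fin p)) :
    Measurable (fun x : Fin p → ℝ => avgMarginal f S (S.restrict x)) :=
  (measurable_avgMarginal H.meas S).comp (Finset.measurable_restrict S)

theorem isMultiplier_avgMarginal (H : IsBoundedDensity f c₁ c₂) (S : Finset (Fin p)) :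
    IsMultiplier (fun x => avgMarginal f S (S.restrict x)) :=
  ⟨H.measurable_avgMarginal_restrict S, max |c₁| |c₂|, fun _ hx =>
    abs_le_max_abs_abs (H.avgMarginal_bound S hx).1 (H.avgMarginal_bound S hx).2⟩

theorem isMultiplier_inv_avgMarginal (H : IsBoundedDensity f c₁ c₂) (S : Finset (Fin p)) :
    IsMultiplier (fun x => (avgMarginal f S (S.restrict x))⁻¹) :=
  IsMultiplier.inv (H.measurable_avgMarginal_restrict S) H.pos fun _ hx =>
    (H.avgMarginal_bound S hx).1

end IsBoundedDensity

/-! ### The subspaces L²_S -/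

/-- Doob–Dynkin factorization. The σ-algebra form is what yields closedness of L²_S. -/
theorem mem_L2S_iff {p : ℕ} {f : (Fin p → ℝ) → ℝ} {S : Finset (Fin p)} {g : L2 f} :
    g ∈ L2S f S ↔ AEStronglyMeasurable[MeasurableSpace.comap
      (S.restrict (π := fun _ : Fin p => ℝ)) MeasurableSpace.pi] g (muF f) := by
  constructor
  · rintro ⟨h, hm, hh⟩
    exact ⟨fun x => h (S.restrict x), (hm.comp
      (comap_measurable (S.restrict (π := fun _ : Fin p => ℝ)))).stronglyMeasurable, hh⟩
  · rintro ⟨u, hu, hg⟩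
    obtain ⟨h, hm, rfl⟩ := hu.exists_eq_measurable_comp
    exact ⟨h, hm.measurable, hg⟩

theorem isClosed_L2S {p : ℕ} (f : (Fin p → ℝ) → ℝ) (S : Finset (Fin p)) :
    IsClosed (L2S f S : Set (L2 f)) := by
  have h := isClosed_aestronglyMeasurable (F := ℝ) (p := 2) (μ := muF f)
    (Finset.measurable_restrict (X := fun _ : Fin p => ℝ) S).comap_le
  have : (L2S f S : Set (L2 f)) = {g : L2 f | AEStronglyMeasurable[MeasurableSpace.comap
      (S.restrict (π := fun _ : Fin p => ℝ)) MeasurableSpace.pi] g (muF f)} :=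
    Set.ext fun _ => mem_L2S_iff
  rwa [this]

theorem L2S_mono {p : ℕ} (f : (Fin p → ℝ) → ℝ) {T S : Finset (Fin p)} (h : T ⊆ S) :
    L2S f T ≤ L2S f S := by
  intro g hg
  obtain ⟨u, hu, hg⟩ := hg
  have hm : Measurable fun a : {j // j ∈ S} → ℝ => u (fun j => a ⟨j, h j.2⟩) :=
    hu.comp (measurable_pi_lambda _ fun j => measurable_pi_apply _)
  exact ⟨_, hm, hg⟩

theorem L2S_univ {p : ℕ} (f : (Fin p → ℝ) → ℝ) : L2S f Finset.univ = ⊤ := by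
  rw [eq_top_iff]
  intro g _
  refine ⟨fun a => g (fun j => a ⟨j, Finset.mem_univ j⟩), ?_, ?_⟩
  · exact (Lp.stronglyMeasurable g).measurable.comp
      (measurable_pi_lambda _ fun j => measurable_pi_apply _)
  · exact Filter.Eventually.of_forall fun x => rfl

theorem mulOp_mem_L2S {p : ℕ} {f w : (Fin p → ℝ) → ℝ} {S : Finset (Fin p)} (hw : IsMultiplier w)
    {v : ({j // j ∈ S} → ℝ) → ℝ} (hv : Measurable v) (hwv : ∀ x, w x = v (S.restrict x))
    {g : L2 f} (hg : g ∈ L2S f S) : mulOp f w g ∈ L2S f S := by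
  obtain ⟨u, hu, hg⟩ := hg
  refine ⟨fun a => v a * u a, hv.mul hu, ?_⟩
  filter_upwards [coeFn_mulOp hw g, hg] with x h1 h2
  rw [h1, h2, hwv]

/-! ### The index set as the set of all exponent vectors -/

/-- The exponents of the tensor product with index `(S, m_S)`: `m_j` for `j ∈ S`, and `0` for the
other coordinates. -/
def Idx.degree {p : ℕ} (i : Idx p) (j : Fin p) : ℕ :=
  if h : j ∈ i.1 then (i.2 ⟨j, h⟩ : ℕ) else 0

theorem Idx.degree_ne_zero_iff {p : ℕ} (i : Idx p) (j : Fin p) : i.degree j ≠ 0 ↔ j ∈ i.1 := by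
  unfold Idx.degree
  split_ifs with h <;> simp [h]

/-- The set S is recovered as the support of the exponent vector, since the m_j are positive. -/
theorem Idx.degree_injective {p : ℕ} : Function.Injective (Idx.degree (p := p)) := by
  rintro ⟨S, m⟩ ⟨T, n⟩ h
  have hST : S = T := by
    ext j
    rw [← Idx.degree_ne_zero_iff ⟨S, m⟩ j, h, Idx.degree_ne_zero_iff ⟨T, n⟩ j]
  subst hST
  congr 1
  ext j
  have := congrFun h j
  simpa [Idx.degree] using this

theorem Idx.degree_surjective {p : ℕ} : Function.Surjective (Idx.degree (p := p)) := by
  intro k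
  refine ⟨⟨Finset.univ.filter (fun j => k j ≠ 0), fun j =>
    ⟨k j, Nat.pos_of_ne_zero (Finset.mem_filter.1 j.2).2⟩⟩, ?_⟩
  ext j
  by_cases h : k j = 0 <;> simp [Idx.degree, h]

/-- The tensor product with index `(S, m_S)` as a function of `x_S`. -/
theorem tensor_degree_eq {p : ℕ} (i : Idx p) (x : Fin p → ℝ) :
    tensor i.degree x = (∏ j : {j // j ∈ i.1}, normLegendre (i.2 j) (i.1.restrict x j)) *
      Real.sqrt (1 / 2) ^ (p - i.1.card) := by
  rw [tensor, ← Fintype.prod_subtype_mul_prod_subtype (fun j => j ∈ i.1)]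
  have h1 : ∀ j : {j // j ∈ i.1}, normLegendre (i.degree j) (x j)
      = normLegendre (i.2 j) (i.1.restrict x j) := by
    intro j
    simp [Idx.degree, Finset.restrict]
  have h2 : ∀ j : {j // ¬ j ∈ i.1}, normLegendre (i.degree j) (x j) = Real.sqrt (1 / 2) := by
    intro j
    rw [Idx.degree, dif_neg j.2, normLegendre_zero]
  simp only [h1, h2, Finset.prod_const, Finset.card_univ, card_compl_subtype]
  congr!

theorem measurable_prod_normLegendre {p : ℕ} (i : Idx p) :
    Measurable fun a : {j // j ∈ i.1} → ℝ => ∏ j, normLegendre (i.2 j) (a j) :=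
  Finset.measurable_prod _ fun j _ =>
    (continuous_normLegendre _).measurable.comp (measurable_pi_apply j)

/-! ### Hierarchically orthogonal functions -/

/-- The functions of `x_S` that are orthogonal to all functions of fewer variables. -/
def hierarchicalSpace {p : ℕ} (f : (Fin p → ℝ) → ℝ) (S : Finset (Fin p)) : Submodule ℝ (L2 f) :=
  L2S f S ⊓ ⨅ T : {T : Finset (Fin p) // T ⊂ S}, (L2S f T)ᗮ

theorem mem_hierarchicalSpace {p : ℕ} {f : (Fin p → ℝ) → ℝ} {S : Finset (Fin p)} {g : L2 f} :
    g ∈ hierarchicalSpace f S ↔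
      g ∈ L2S f S ∧ ∀ T, T ⊂ S → ∀ h ∈ L2S f T, inner ℝ g h = 0 := by
  simp only [hierarchicalSpace, Submodule.mem_inf, Submodule.mem_iInf, Subtype.forall,
    Submodule.mem_orthogonal']

theorem isClosed_hierarchicalSpace {p : ℕ} (f : (Fin p → ℝ) → ℝ) (S : Finset (Fin p)) :
    IsClosed (hierarchicalSpace f S : Set (L2 f)) := by
  rw [hierarchicalSpace, Submodule.coe_inf, Submodule.coe_iInf]
  exact (isClosed_L2S f S).inter (isClosed_iInter fun T => Submodule.isClosed_orthogonal _)

theorem feasible_iff {p : ℕ} {f : (Fin p → ℝ) → ℝ} {g : Finset (Fin p) → L2 f} :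
    Feasible f g ↔ ∀ S, g S ∈ hierarchicalSpace f S := by
  simp only [Feasible, mem_hierarchicalSpace, inner_eq_integral]
  exact ⟨fun h S => ⟨h.1 S, fun T => h.2 T S⟩, fun h => ⟨fun S => (h S).1, fun T S => (h S).2 T⟩⟩

/-! ### The orthonormal basis, and passage to the marginal weight -/

namespace IsBoundedDensity

variable {p : ℕ} {f : (Fin p → ℝ) → ℝ} {c₁ c₂ : ℝ}

theorem memLp_two (H : IsBoundedDensity f c₁ c₂) {w : (Fin p → ℝ) → ℝ} (hw : IsMultiplier w) :
    MemLp w 2 (muF f) :=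
  have := H.isFiniteMeasure
  hw.memLp.mono_exponent le_top

theorem isMultiplier_tensor_div_sqrt (H : IsBoundedDensity f c₁ c₂) (k : Fin p → ℕ) :
    IsMultiplier fun x => tensor k x * (Real.sqrt (f x))⁻¹ :=
  (IsMultiplier.of_continuous (continuous_tensor k)).mul H.isMultiplier_inv_sqrt

/-- The orthonormal family of `L²` obtained from the Legendre tensor products. -/
def legendreVec (H : IsBoundedDensity f c₁ c₂) (i : Idx p) : L2 f :=
  (H.memLp_two (H.isMultiplier_tensor_div_sqrt i.degree)).toLp _

theorem coeFn_legendreVec (H : IsBoundedDensity f c₁ c₂) (i : Idx p) :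
    ∀ᵐ x ∂(muF f), H.legendreVec i x = tensor i.degree x * (Real.sqrt (f x))⁻¹ :=
  MemLp.coeFn_toLp _

theorem inner_legendreVec (H : IsBoundedDensity f c₁ c₂) (i : Idx p) (g : L2 f) :
    inner ℝ (H.legendreVec i) g
      = ∫ x, (g x * Real.sqrt (f x)) * tensor i.degree x ∂(cube (Fin p)) := by
  rw [inner_eq_integral, H.integral_muF]
  refine integral_congr_ae ?_
  filter_upwards [H.ae_cube (H.coeFn_legendreVec i), ae_mem_cube (Fin p)] with x h1 hx
  have hpos := H.pos_of_mem hx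
  have hs := Real.sqrt_pos.2 hpos
  rw [h1]
  nth_rewrite 2 [← Real.mul_self_sqrt hpos.le]
  field_simp

theorem orthonormal_legendreVec (H : IsBoundedDensity f c₁ c₂) :
    Orthonormal ℝ H.legendreVec := by
  classical
  rw [orthonormal_iff_ite]
  intro i i'
  rw [inner_legendreVec]
  have : ∫ x, (H.legendreVec i' x * Real.sqrt (f x)) * tensor i.degree x ∂(cube (Fin p))
      = ∫ x, tensor i.degree x * tensor i'.degree x ∂(cube (Fin p)) := by
    refine integral_congr_ae ?_
    filter_upwards [H.ae_cube (H.coeFn_legendreVec i'), ae_mem_cube (Fin p)] with x h1 hx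
    have hs := Real.sqrt_pos.2 (H.pos_of_mem hx)
    rw [h1]
    field_simp
  rw [this, integral_tensor_mul]
  simp only [Idx.degree_injective.eq_iff]

theorem eq_zero_of_inner_legendreVec (H : IsBoundedDensity f c₁ c₂) {g : L2 f}
    (hg : ∀ i, inner ℝ (H.legendreVec i) g = 0) : g = 0 := by
  have := H.isFiniteMeasure
  have hint : Integrable (fun x => g x * Real.sqrt (f x)) (cube (Fin p)) := by
    refine H.integrable_cube ?_
    obtain ⟨hm, C, hC⟩ := H.isMultiplier_sqrt
    exact ((Lp.memLp g).integrable (by norm_num)).mul_bdd (c := C) hm.aestronglyMeasurable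
      ((ae_muF_mem_cube f).mono hC)
  have h0 : ∀ᵐ x ∂(cube (Fin p)), g x * Real.sqrt (f x) = 0 := by
    refine ae_eq_zero_of_integral_tensor_eq_zero hint fun k => ?_
    obtain ⟨i, rfl⟩ := Idx.degree_surjective k
    rw [← H.inner_legendreVec, hg]
  rw [Lp.eq_zero_iff_ae_eq_zero]
  filter_upwards [(withDensity_absolutelyContinuous _ _).ae_le h0, ae_muF_mem_cube f] with x h1 hx
  exact (mul_eq_zero.1 h1).resolve_right (Real.sqrt_pos.2 (H.pos_of_mem hx)).ne'

/-- The orthonormal basis of `L²` obtained from the Legendre tensor products. -/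
def legendreBasis (H : IsBoundedDensity f c₁ c₂) : HilbertBasis (Idx p) ℝ (L2 f) :=
  HilbertBasis.mkOfOrthogonalEqBot H.orthonormal_legendreVec (by
    rw [Submodule.eq_bot_iff]
    intro g hg
    exact H.eq_zero_of_inner_legendreVec fun i =>
      (Submodule.mem_orthogonal _ _).1 hg _ (Submodule.subset_span ⟨i, rfl⟩))

theorem legendreBasis_apply (H : IsBoundedDensity f c₁ c₂) (i : Idx p) :
    H.legendreBasis i = H.legendreVec i := by
  rw [legendreBasis, HilbertBasis.coe_mkOfOrthogonalEqBot]

/-- Tensor products that depend on some variable outside `T` are orthogonal to the functions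
of `x_T`. -/
theorem inner_legendreBasis_mulOp_inv_sqrt (H : IsBoundedDensity f c₁ c₂) {i : Idx p}
    {T : Finset (Fin p)} (hi : ¬ i.1 ⊆ T) {h : L2 f} (hh : h ∈ L2S f T) :
    inner ℝ (H.legendreBasis i) (mulOp f (fun x => (Real.sqrt (f x))⁻¹) h) = 0 := by
  obtain ⟨u, hu, hhu⟩ := hh
  obtain ⟨j, hj, hjT⟩ := Finset.not_subset.1 hi
  rw [legendreBasis_apply, inner_legendreVec,
    ← integral_tensor_mul_restrict hjT ((i.degree_ne_zero_iff j).2 hj) u]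
  refine integral_congr_ae ?_
  filter_upwards [H.ae_cube hhu, H.ae_cube (coeFn_mulOp H.isMultiplier_inv_sqrt h),
    ae_mem_cube (Fin p)] with x h1 h2 hx
  have hs := Real.sqrt_pos.2 (H.pos_of_mem hx)
  rw [h2, h1]
  field_simp

theorem isMultiplier_marginal_div (H : IsBoundedDensity f c₁ c₂) (S : Finset (Fin p)) :
    IsMultiplier fun x => avgMarginal f S (S.restrict x) * (f x)⁻¹ :=
  (H.isMultiplier_avgMarginal S).mul H.isMultiplier_inv

theorem isMultiplier_marginal_div_sqrt (H : IsBoundedDensity f c₁ c₂) (S : Finset (Fin p)) :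
    IsMultiplier fun x => avgMarginal f S (S.restrict x) * (Real.sqrt (f x))⁻¹ :=
  (H.isMultiplier_avgMarginal S).mul H.isMultiplier_inv_sqrt

theorem isMultiplier_sqrt_div_marginal (H : IsBoundedDensity f c₁ c₂) (S : Finset (Fin p)) :
    IsMultiplier fun x => Real.sqrt (f x) * (avgMarginal f S (S.restrict x))⁻¹ :=
  H.isMultiplier_sqrt.mul (H.isMultiplier_inv_avgMarginal S)

/-- For functions of `x_S`, the density may be replaced by the marginal density. -/
theorem inner_eq_inner_mulOp (H : IsBoundedDensity f c₁ c₂) {S : Finset (Fin p)} {g h : L2 f}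
    (hg : g ∈ L2S f S) (hh : h ∈ L2S f S) :
    inner ℝ g h
      = inner ℝ g (mulOp f (fun x => avgMarginal f S (S.restrict x) * (f x)⁻¹) h) := by
  obtain ⟨u, hu, hgu⟩ := hg
  obtain ⟨v, hv, hhv⟩ := hh
  have hint : Integrable (fun x => u (S.restrict x) * v (S.restrict x)) (cube (Fin p)) := by
    refine (H.integrable_cube (integrable_mul g h)).congr ?_
    filter_upwards [H.ae_cube hgu, H.ae_cube hhv] with x h1 h2
    rw [h1, h2]
  have key := integral_restrict_mul_density H.meas H.bound S (h := fun a => u a * v a) hint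
  rw [inner_eq_integral, inner_eq_integral, H.integral_muF, H.integral_muF]
  refine Eq.trans ?_ (key.trans ?_)
  · refine integral_congr_ae ?_
    filter_upwards [H.ae_cube hgu, H.ae_cube hhv] with x h1 h2
    rw [h1, h2]
  · refine integral_congr_ae ?_
    filter_upwards [H.ae_cube hgu, H.ae_cube hhv, ae_mem_cube (Fin p),
      H.ae_cube (coeFn_mulOp (H.isMultiplier_marginal_div S) h)] with x h1 h2 hx h3
    have := H.pos_of_mem hx
    rw [h3, h1, h2]
    field_simp

/-- Multiplication by `√f / N_S`, where `N_S` is the averaged marginal density. -/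
def dualOp (_ : IsBoundedDensity f c₁ c₂) (S : Finset (Fin p)) : L2 f →L[ℝ] L2 f :=
  mulOp f fun x => Real.sqrt (f x) * (avgMarginal f S (S.restrict x))⁻¹

/-- Multiplication by `N_S / √f`, the inverse of `dualOp`. -/
def dualOpInv (_ : IsBoundedDensity f c₁ c₂) (S : Finset (Fin p)) : L2 f →L[ℝ] L2 f :=
  mulOp f fun x => avgMarginal f S (S.restrict x) * (Real.sqrt (f x))⁻¹

theorem dualOp_dualOpInv (H : IsBoundedDensity f c₁ c₂) (S : Finset (Fin p)) (g : L2 f) :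
    H.dualOp S (H.dualOpInv S g) = g := by
  rw [dualOp, dualOpInv, mulOp_mulOp (H.isMultiplier_sqrt_div_marginal S)
    (H.isMultiplier_marginal_div_sqrt S) (.of_continuous continuous_const) (u := fun _ => 1),
    mulOp_one]
  intro x hx
  have := Real.sqrt_pos.2 (H.pos_of_mem hx)
  have := H.pos.trans_le (H.avgMarginal_bound S hx).1
  field_simp

theorem dualOpInv_dualOp (H : IsBoundedDensity f c₁ c₂) (S : Finset (Fin p)) (g : L2 f) :
    H.dualOpInv S (H.dualOp S g) = g := by
  rw [dualOp, dualOpInv, mulOp_mulOp (H.isMultiplier_marginal_div_sqrt S)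
    (H.isMultiplier_sqrt_div_marginal S) (.of_continuous continuous_const) (u := fun _ => 1),
    mulOp_one]
  intro x hx
  have := Real.sqrt_pos.2 (H.pos_of_mem hx)
  have := H.pos.trans_le (H.avgMarginal_bound S hx).1
  field_simp

theorem coeFn_dualOp_legendreBasis (H : IsBoundedDensity f c₁ c₂) (i : Idx p) (S : Finset (Fin p)) :
    ∀ᵐ x ∂(muF f), H.dualOp S (H.legendreBasis i) x
      = tensor i.degree x / avgMarginal f S (S.restrict x) := by
  rw [legendreBasis_apply]
  filter_upwards [coeFn_mulOp (H.isMultiplier_sqrt_div_marginal S) (H.legendreVec i),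
    H.coeFn_legendreVec i, ae_muF_mem_cube f] with x h1 h2 hx
  have := Real.sqrt_pos.2 (H.pos_of_mem hx)
  rw [dualOp, h1, h2]
  field_simp

/-- The factors multiply to (√f / N_S)(N_S / f) = 1/√f, so the marginal disappears. -/
theorem inner_dualOp_marginal (H : IsBoundedDensity f c₁ c₂) (S : Finset (Fin p)) (u h : L2 f) :
    inner ℝ (H.dualOp S u) (mulOp f (fun x => avgMarginal f S (S.restrict x) * (f x)⁻¹) h)
      = inner ℝ u (mulOp f (fun x => (Real.sqrt (f x))⁻¹) h) := by
  rw [dualOp, inner_mulOp (H.isMultiplier_sqrt_div_marginal S),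
    mulOp_mulOp (H.isMultiplier_sqrt_div_marginal S) (H.isMultiplier_marginal_div S)
      H.isMultiplier_inv_sqrt]
  intro x hx
  have hpos := H.pos_of_mem hx
  have := Real.sqrt_pos.2 hpos
  have := H.pos.trans_le (H.avgMarginal_bound S hx).1
  nth_rewrite 2 [← Real.mul_self_sqrt hpos.le]
  field_simp

/-- Against a function h of x_T with T ⊊ S, the weight N_S turns the inner product into the Lebesgue
integral of the tensor product times h, and the tensor product has a nonconstant factor outside T.
-/
theorem dualOp_legendreBasis_mem (H : IsBoundedDensity f c₁ c₂) (i : Idx p) :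
    H.dualOp i.1 (H.legendreBasis i) ∈ hierarchicalSpace f i.1 := by
  have hmem : H.dualOp i.1 (H.legendreBasis i) ∈ L2S f i.1 := by
    refine ⟨fun a => (∏ j, normLegendre (i.2 j) (a j)) * Real.sqrt (1 / 2) ^ (p - i.1.card)
      / avgMarginal f i.1 a, ((measurable_prod_normLegendre i).mul_const _).div
        (measurable_avgMarginal H.meas _), ?_⟩
    filter_upwards [H.coeFn_dualOp_legendreBasis i i.1] with x h1
    rw [h1, tensor_degree_eq]
  rw [mem_hierarchicalSpace]
  refine ⟨hmem, fun T hT h hh => ?_⟩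
  rw [H.inner_eq_inner_mulOp hmem (L2S_mono f hT.1 hh), inner_dualOp_marginal]
  exact H.inner_legendreBasis_mulOp_inv_sqrt hT.2 hh

/-- The coefficients outside `S` of a hierarchically orthogonal function of `x_S`, multiplied by
the marginal density, vanish. -/
theorem inner_legendreBasis_dualOpInv (H : IsBoundedDensity f c₁ c₂) {i : Idx p}
    {S : Finset (Fin p)} (hi : i.1 ≠ S) {r : L2 f} (hr : r ∈ hierarchicalSpace f S) :
    inner ℝ (H.legendreBasis i) (H.dualOpInv S r) = 0 := by
  rw [mem_hierarchicalSpace] at hr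
  -- If the index set is a proper subset of S, the tensor product is an admissible test function for
  -- r. Otherwise it has a nonconstant factor in a variable on which N_S r does not depend.
  by_cases hiS : i.1 ⊆ S
  · have ht : mulOp f (fun x => Real.sqrt (f x)) (H.legendreBasis i) ∈ L2S f i.1 := by
      refine ⟨fun a => (∏ j, normLegendre (i.2 j) (a j)) * Real.sqrt (1 / 2) ^ (p - i.1.card),
        (measurable_prod_normLegendre i).mul_const _, ?_⟩
      rw [legendreBasis_apply]
      filter_upwards [coeFn_mulOp H.isMultiplier_sqrt (H.legendreVec i), H.coeFn_legendreVec i,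
        ae_muF_mem_cube f] with x h1 h2 hx
      have := Real.sqrt_pos.2 (H.pos_of_mem hx)
      rw [h1, h2, ← tensor_degree_eq]
      field_simp
    have h0 := hr.2 i.1 (hiS.ssubset_of_ne hi) _ ht
    rw [real_inner_comm, H.inner_eq_inner_mulOp (L2S_mono f hiS ht) hr.1,
      inner_mulOp H.isMultiplier_sqrt, mulOp_mulOp H.isMultiplier_sqrt
        (H.isMultiplier_marginal_div S) (H.isMultiplier_marginal_div_sqrt S)] at h0
    · exact h0
    intro x hx
    have hpos := H.pos_of_mem hx
    have := Real.sqrt_pos.2 hpos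
    nth_rewrite 2 [← Real.mul_self_sqrt hpos.le]
    field_simp
  · have hN : mulOp f (fun x => avgMarginal f S (S.restrict x)) r ∈ L2S f S :=
      mulOp_mem_L2S (H.isMultiplier_avgMarginal S) (measurable_avgMarginal H.meas S)
        (fun _ => rfl) hr.1
    have h0 := H.inner_legendreBasis_mulOp_inv_sqrt hiS hN
    rwa [mulOp_mulOp H.isMultiplier_inv_sqrt (H.isMultiplier_avgMarginal S)
      (H.isMultiplier_marginal_div_sqrt S) fun x _ => mul_comm _ _] at h0

end IsBoundedDensity

/-! ### Projections onto the levels S -/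

namespace IsBoundedDensity

variable {p : ℕ} {f : (Fin p → ℝ) → ℝ} {c₁ c₂ : ℝ}

/-- The closed span of the basis vectors with index set `S`. -/
def levelSpace (H : IsBoundedDensity f c₁ c₂) (S : Finset (Fin p)) : Submodule ℝ (L2 f) :=
  (Submodule.span ℝ (H.legendreBasis '' {i | i.1 = S})).topologicalClosure

instance (H : IsBoundedDensity f c₁ c₂) (S : Finset (Fin p)) : CompleteSpace (H.levelSpace S) :=
  inferInstanceAs (CompleteSpace (Submodule.topologicalClosure _))

/-- The orthogonal projection onto `levelSpace`. -/
def levelProj (H : IsBoundedDensity f c₁ c₂) (S : Finset (Fin p)) : L2 f →L[ℝ] L2 f :=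
  (H.levelSpace S).starProjection

theorem levelSpace_le (H : IsBoundedDensity f c₁ c₂) {S : Finset (Fin p)} {W : Submodule ℝ (L2 f)}
    (hW : IsClosed (W : Set (L2 f))) (h : ∀ i : Idx p, i.1 = S → H.legendreBasis i ∈ W) :
    H.levelSpace S ≤ W := by
  refine Submodule.topologicalClosure_minimal _ (Submodule.span_le.2 ?_) hW
  rintro _ ⟨i, hi, rfl⟩
  exact h i hi

theorem legendreBasis_mem_levelSpace (H : IsBoundedDensity f c₁ c₂) (i : Idx p) :
    H.legendreBasis i ∈ H.levelSpace i.1 :=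
  Submodule.le_topologicalClosure _ (Submodule.subset_span ⟨i, rfl, rfl⟩)

theorem inner_eq_zero_of_mem_levelSpace (H : IsBoundedDensity f c₁ c₂) {S : Finset (Fin p)}
    {x u : L2 f} (hx : ∀ i : Idx p, i.1 = S → inner ℝ (H.legendreBasis i) x = 0)
    (hu : u ∈ H.levelSpace S) : inner ℝ u x = 0 := by
  have : H.levelSpace S ≤ (ℝ ∙ x)ᗮ :=
    H.levelSpace_le (Submodule.isClosed_orthogonal _) fun i hi => by
      rw [Submodule.mem_orthogonal_singleton_iff_inner_left]
      exact hx i hi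
  exact Submodule.mem_orthogonal_singleton_iff_inner_left.1 (this hu)

theorem levelProj_eq_zero (H : IsBoundedDensity f c₁ c₂) {S : Finset (Fin p)} {x : L2 f}
    (hx : ∀ i : Idx p, i.1 = S → inner ℝ (H.legendreBasis i) x = 0) : H.levelProj S x = 0 := by
  rw [levelProj, Submodule.starProjection_apply_eq_zero_iff, Submodule.mem_orthogonal]
  exact fun u hu => H.inner_eq_zero_of_mem_levelSpace hx hu

theorem levelProj_legendreBasis (H : IsBoundedDensity f c₁ c₂) (S : Finset (Fin p)) (i : Idx p) :
    H.levelProj S (H.legendreBasis i) = if i.1 = S then H.legendreBasis i else 0 := by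
  split_ifs with h
  · subst h
    exact Submodule.starProjection_eq_self_iff.2 (H.legendreBasis_mem_levelSpace i)
  · refine H.levelProj_eq_zero fun i' hi' => ?_
    refine H.legendreBasis.orthonormal.2 ?_
    rintro rfl
    exact h hi'

theorem sum_levelProj (H : IsBoundedDensity f c₁ c₂) (x : L2 f) : ∑ S, H.levelProj S x = x := by
  have : ∑ S, H.levelProj S = ContinuousLinearMap.id ℝ (L2 f) := by
    refine ContinuousLinearMap.ext_on
      (Submodule.dense_iff_topologicalClosure_eq_top.2 H.legendreBasis.dense_span) ?_
    rintro _ ⟨i, rfl⟩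
    simp [levelProj_legendreBasis]
  simpa [sum_apply] using
    congrArg (fun A : L2 f →L[ℝ] L2 f => A x) this

theorem levelProj_eq_ite (H : IsBoundedDensity f c₁ c₂) {S : Finset (Fin p)} {x : L2 f}
    (hx : ∀ i : Idx p, i.1 ≠ S → inner ℝ (H.legendreBasis i) x = 0) (T : Finset (Fin p)) :
    H.levelProj T x = if T = S then x else 0 := by
  have h0 : ∀ T, T ≠ S → H.levelProj T x = 0 := fun T hT =>
    H.levelProj_eq_zero fun i hi => hx i (hi ▸ hT)
  split_ifs with h
  · subst h
    conv_rhs => rw [← H.sum_levelProj x]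
    rw [Finset.sum_eq_single T (fun T' _ h => h0 T' h) (by simp)]
  · exact h0 T h

theorem hasSum_levelProj (H : IsBoundedDensity f c₁ c₂) (S : Finset (Fin p)) (x : L2 f) :
    HasSum (fun m : {j // j ∈ S} → ℕ+ =>
      H.legendreBasis.repr x ⟨S, m⟩ • H.legendreBasis ⟨S, m⟩) (H.levelProj S x) := by
  have h := (H.legendreBasis.hasSum_repr x).mapL (H.levelProj S)
  simp only [map_smul, levelProj_legendreBasis] at h
  have hinj : Function.Injective (fun m : {j // j ∈ S} → ℕ+ => (⟨S, m⟩ : Idx p)) :=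
    fun m n h => eq_of_heq (Sigma.mk.inj h).2
  -- The projected expansion has zero terms off level S, so it may be restricted to the indices (S,
  -- m).
  rw [← hinj.hasSum_iff] at h
  · simpa [Function.comp_def] using h
  · rintro ⟨T, m⟩ hT
    have : T ≠ S := by
      rintro rfl
      exact hT ⟨m, rfl⟩
    simp [this]

/-- True for basis vectors, and extended to their closed span because the hierarchical space is
closed. -/
theorem dualOp_levelProj_mem (H : IsBoundedDensity f c₁ c₂) (S : Finset (Fin p)) (x : L2 f) :
    H.dualOp S (H.levelProj S x) ∈ hierarchicalSpace f S := by
  have : H.levelSpace S ≤ (hierarchicalSpace f S).comap (H.dualOp S).toLinearMap := by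
    refine H.levelSpace_le ((isClosed_hierarchicalSpace f S).preimage (H.dualOp S).continuous) ?_
    rintro i rfl
    exact H.dualOp_legendreBasis_mem i
  exact this (Submodule.starProjection_apply_mem _ x)

theorem levelProj_dualOpInv (H : IsBoundedDensity f c₁ c₂) {S : Finset (Fin p)} {r : L2 f}
    (hr : r ∈ hierarchicalSpace f S) (T : Finset (Fin p)) :
    H.levelProj T (H.dualOpInv S r) = if T = S then H.dualOpInv S r else 0 :=
  H.levelProj_eq_ite (fun _ hi => H.inner_legendreBasis_dualOpInv hi hr) T

/-- A hierarchically orthogonal function of `x_S` is orthogonal, for the product of the marginal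
law of `X_S` and the uniform law, to the functions of `x_T` unless `S ⊆ T`. -/
theorem inner_marginal_eq_zero (H : IsBoundedDensity f c₁ c₂) {S T : Finset (Fin p)}
    (hST : ¬ S ⊆ T) {g h : L2 f} (hg : g ∈ hierarchicalSpace f S) (hh : h ∈ L2S f T) :
    inner ℝ g (mulOp f (fun x => avgMarginal f S (S.restrict x) * (f x)⁻¹) h) = 0 := by
  -- After undoing `dualOp`, the left factor lies on level S, whose basis vectors are orthogonal to
  -- h/√f because S is not contained in T.
  rw [← H.dualOp_dualOpInv S g, inner_dualOp_marginal]
  refine H.inner_eq_zero_of_mem_levelSpace (S := S) ?_ ?_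
  · rintro i rfl
    exact H.inner_legendreBasis_mulOp_inv_sqrt hST hh
  · have := H.levelProj_dualOpInv hg S
    rw [if_pos rfl] at this
    exact Submodule.starProjection_eq_self_iff.1 this

/-! ### Stability of hierarchical sums -/

/-- For the weight N_S, Pythagoras holds between g_S and the sum of the others. Comparing this
weight with f costs c₁/c₂ on one side and c₂/c₁ on the other, hence (c₂/c₁)² for squared norms. -/
theorem norm_le_of_maximal (H : IsBoundedDensity f c₁ c₂) {S : Finset (Fin p)}
    {𝓕 : Finset (Finset (Fin p))} (h𝓕 : ∀ T ∈ 𝓕, ¬ S ⊆ T) {g : Finset (Fin p) → L2 f}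
    (hg : ∀ T, g T ∈ hierarchicalSpace f T) :
    ‖g S‖ ≤ c₂ / c₁ * ‖g S + ∑ T ∈ 𝓕, g T‖ := by
  have hc₂ : 0 < c₂ := H.pos.trans_le H.le
  have hw := H.isMultiplier_marginal_div S
  have hbd : ∀ x ∈ Set.Icc (-1 : Fin p → ℝ) 1,
      c₁ / c₂ ≤ avgMarginal f S (S.restrict x) * (f x)⁻¹ ∧
      avgMarginal f S (S.restrict x) * (f x)⁻¹ ≤ c₂ / c₁ := by
    intro x hx
    rw [← div_eq_mul_inv]
    have h1 := H.avgMarginal_bound S hx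
    have h2 := H.bound x hx
    exact ⟨div_le_div₀ (H.pos.le.trans h1.1) h1.1 (H.pos_of_mem hx) h2.2,
      div_le_div₀ hc₂.le h1.2 H.pos h2.1⟩
  set D := mulOp f fun x => avgMarginal f S (S.restrict x) * (f x)⁻¹ with hD
  set h := ∑ T ∈ 𝓕, g T with hh
  have hcross : inner ℝ (g S) (D h) = 0 := by
    rw [hh, map_sum, inner_sum]
    exact Finset.sum_eq_zero fun T hT =>
      H.inner_marginal_eq_zero (h𝓕 T hT) (hg S) (mem_hierarchicalSpace.1 (hg T)).1
  have hcross' : inner ℝ h (D (g S)) = 0 := by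
    rw [hD, ← inner_mulOp hw, real_inner_comm]
    exact hcross
  have e : inner ℝ (g S + h) (D (g S + h)) = inner ℝ (g S) (D (g S)) + inner ℝ h (D h) := by
    rw [map_add, inner_add_left, inner_add_right, inner_add_right, hcross, hcross']
    ring
  have h1 := le_inner_mulOp_self hw (fun x hx => (hbd x hx).1) (g S)
  have h2 := le_inner_mulOp_self hw (fun x hx => (hbd x hx).1) h
  have h3 := inner_mulOp_self_le hw (fun x hx => (hbd x hx).2) (g S + h)
  rw [← hD] at h1 h2 h3
  have h4 : 0 ≤ c₁ / c₂ * ‖h‖ ^ 2 := mul_nonneg (div_nonneg H.pos.le hc₂.le) (sq_nonneg _)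
  have h5 : c₁ / c₂ * ‖g S‖ ^ 2 ≤ c₂ / c₁ * ‖g S + h‖ ^ 2 := by linarith
  have h6 := mul_le_mul_of_nonneg_left h5 (div_pos hc₂ H.pos).le
  have hcc : c₂ / c₁ * (c₁ / c₂) = 1 := by
    have := H.pos
    field_simp
  rw [← mul_assoc, hcc, one_mul] at h6
  refine abs_le_of_sq_le_sq' ?_ (mul_nonneg (div_pos hc₂ H.pos).le (norm_nonneg _)) |>.2
  nlinarith

/-- The hierarchically orthogonal components are controlled by their sum. -/
theorem exists_norm_le_sum (H : IsBoundedDensity f c₁ c₂) (𝓕 : Finset (Finset (Fin p))) :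
    ∃ K : ℝ, 0 ≤ K ∧ ∀ g : Finset (Fin p) → L2 f, (∀ T, g T ∈ hierarchicalSpace f T) →
      ∀ S ∈ 𝓕, ‖g S‖ ≤ K * ‖∑ T ∈ 𝓕, g T‖ := by
  -- A set of largest cardinality is added last, so it is contained in none of the others.
  refine Finset.induction_on_max_value Finset.card 𝓕 ⟨0, le_rfl, by simp⟩
    fun S 𝓕 hS hmax ih => ?_
  obtain ⟨K, hK, ih⟩ := ih
  have hC : 0 ≤ c₂ / c₁ := div_nonneg (H.pos.le.trans H.le) H.pos.le
  have hnot : ∀ T ∈ 𝓕, ¬ S ⊆ T := by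
    intro T hT hST
    exact hS (Finset.eq_of_subset_of_card_le hST (hmax T hT) ▸ hT)
  -- The first term bounds the new component; the second bounds the old ones, whose sum is y - g S.
  refine ⟨c₂ / c₁ + K * (1 + c₂ / c₁), by positivity, fun g hg T hT => ?_⟩
  rw [Finset.sum_insert hS]
  have h1 := H.norm_le_of_maximal hnot hg
  set y := g S + ∑ T ∈ 𝓕, g T with hy
  have h2 : ‖∑ T ∈ 𝓕, g T‖ ≤ (1 + c₂ / c₁) * ‖y‖ := by
    have : ∑ T ∈ 𝓕, g T = y - g S := by rw [hy]; abel
    rw [this]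
    linarith [norm_sub_le y (g S)]
  have h3 : 0 ≤ K * (1 + c₂ / c₁) * ‖y‖ := by positivity
  have h4 : 0 ≤ c₂ / c₁ * ‖y‖ := by positivity
  rw [add_mul]
  rcases Finset.mem_insert.1 hT with rfl | hT
  · linarith
  · have := (ih g hg T hT).trans (mul_le_mul_of_nonneg_left h2 hK)
    linarith

/-! ### Invertibility of the synthesis operator -/

/-- The operator that maps the orthonormal basis to the scaled Legendre tensor products divided by
marginal densities. -/
def synthesisOp (H : IsBoundedDensity f c₁ c₂) (c : Finset (Fin p) → ℝ) : L2 f →L[ℝ] L2 f :=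
  ∑ S, c S • (H.dualOp S ∘L H.levelProj S)

theorem synthesisOp_apply (H : IsBoundedDensity f c₁ c₂) (c : Finset (Fin p) → ℝ) (x : L2 f) :
    H.synthesisOp c x = ∑ S, c S • H.dualOp S (H.levelProj S x) := by
  simp [synthesisOp]

theorem synthesisOp_legendreBasis (H : IsBoundedDensity f c₁ c₂) (c : Finset (Fin p) → ℝ)
    (i : Idx p) : H.synthesisOp c (H.legendreBasis i)
      = c i.1 • H.dualOp i.1 (H.legendreBasis i) := by
  rw [synthesisOp_apply, Finset.sum_eq_single i.1]
  · simp [levelProj_legendreBasis]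
  · intro S _ hS
    simp [levelProj_legendreBasis, hS.symm]
  · simp

/-- The image is a sum of hierarchically orthogonal components, each controlled by the whole;
inverting `dualOp` level by level recovers x. -/
theorem exists_norm_le_synthesisOp (H : IsBoundedDensity f c₁ c₂) {c : Finset (Fin p) → ℝ}
    (hc : ∀ S, c S ≠ 0) : ∃ K : ℝ, 0 ≤ K ∧ ∀ x, ‖x‖ ≤ K * ‖H.synthesisOp c x‖ := by
  obtain ⟨K, hK, h⟩ := H.exists_norm_le_sum Finset.univ
  refine ⟨∑ S, ‖H.dualOpInv S‖ * (‖(c S)⁻¹‖ * K), by positivity, fun x => ?_⟩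
  have hg : ∀ S, c S • H.dualOp S (H.levelProj S x) ∈ hierarchicalSpace f S := fun S =>
    Submodule.smul_mem _ _ (H.dualOp_levelProj_mem S x)
  conv_lhs => rw [← H.sum_levelProj x]
  rw [Finset.sum_mul]
  refine (norm_sum_le _ _).trans (Finset.sum_le_sum fun S _ => ?_)
  have h1 := h _ hg S (Finset.mem_univ S)
  rw [← synthesisOp_apply] at h1
  have h2 : H.levelProj S x
      = H.dualOpInv S ((c S)⁻¹ • (c S • H.dualOp S (H.levelProj S x))) := by
    rw [inv_smul_smul₀ (hc S), dualOpInv_dualOp]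
  rw [h2, mul_assoc, mul_assoc]
  refine (ContinuousLinearMap.le_opNorm _ _).trans (mul_le_mul_of_nonneg_left ?_ (norm_nonneg _))
  rw [norm_smul]
  exact mul_le_mul_of_nonneg_left h1 (norm_nonneg _)

/-- An explicit preimage exists: N_S r / √f lies entirely on level S, so only one term of the
operator acts on it. -/
theorem hierarchicalSpace_le_range (H : IsBoundedDensity f c₁ c₂) {c : Finset (Fin p) → ℝ}
    (hc : ∀ S, c S ≠ 0) (S : Finset (Fin p)) :
    hierarchicalSpace f S ≤ LinearMap.range (H.synthesisOp c).toLinearMap := by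
  intro r hr
  refine ⟨(c S)⁻¹ • H.dualOpInv S r, ?_⟩
  rw [ContinuousLinearMap.coe_coe, synthesisOp_apply, Finset.sum_eq_single S]
  · rw [map_smul, H.levelProj_dualOpInv hr, if_pos rfl, map_smul, smul_inv_smul₀ (hc S),
      dualOp_dualOpInv]
  · intro T _ hT
    rw [map_smul, H.levelProj_dualOpInv hr, if_neg hT]
    simp
  · simp

theorem L2S_le_range (H : IsBoundedDensity f c₁ c₂) {c : Finset (Fin p) → ℝ}
    (hc : ∀ S, c S ≠ 0)
    (hclosed : IsClosed (LinearMap.range (H.synthesisOp c).toLinearMap : Set (L2 f)))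
    (S : Finset (Fin p)) : L2S f S ≤ LinearMap.range (H.synthesisOp c).toLinearMap := by
  induction S using Finset.strongInduction with
  | H S ih =>
    -- The closure makes the orthogonal projection available; closedness of the range keeps W inside
    -- it.
    let W : Submodule ℝ (L2 f) := (⨆ T : {T : Finset (Fin p) // T ⊂ S}, L2S f T).topologicalClosure
    have : CompleteSpace W := inferInstanceAs (CompleteSpace (Submodule.topologicalClosure _))
    have hWr : W ≤ LinearMap.range (H.synthesisOp c).toLinearMap :=
      Submodule.topologicalClosure_minimal _ (iSup_le fun T => ih T T.2) hclosed
    have hWS : W ≤ L2S f S :=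
      Submodule.topologicalClosure_minimal _ (iSup_le fun T => L2S_mono f T.2.1) (isClosed_L2S f S)
    intro n hn
    have hP : W.starProjection n ∈ W := Submodule.starProjection_apply_mem _ n
    have hr : n - W.starProjection n ∈ hierarchicalSpace f S := by
      refine mem_hierarchicalSpace.2 ⟨Submodule.sub_mem _ hn (hWS hP), fun T hT h hh => ?_⟩
      refine Submodule.inner_left_of_mem_orthogonal (K := W) ?_
        (Submodule.sub_starProjection_mem_orthogonal n)
      exact Submodule.le_topologicalClosure _
        (Submodule.mem_iSup_of_mem (⟨T, hT⟩ : {T : Finset (Fin p) // T ⊂ S}) hh)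
    have := Submodule.add_mem _ (H.hierarchicalSpace_le_range hc S hr) (hWr hP)
    rwa [sub_add_cancel] at this

theorem exists_synthesisEquiv (H : IsBoundedDensity f c₁ c₂) {c : Finset (Fin p) → ℝ}
    (hc : ∀ S, c S ≠ 0) : ∃ A : L2 f ≃L[ℝ] L2 f, ∀ x, A x = H.synthesisOp c x := by
  obtain ⟨K, hK, h⟩ := H.exists_norm_le_synthesisOp hc
  have hanti : AntilipschitzWith K.toNNReal (H.synthesisOp c) := by
    refine ContinuousLinearMap.antilipschitz_of_bound _ fun x => ?_
    rw [Real.coe_toNNReal K hK]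
    exact h x
  have hker : LinearMap.ker (H.synthesisOp c).toLinearMap = ⊥ :=
    LinearMap.ker_eq_bot.2 hanti.injective
  have hclosed : IsClosed (LinearMap.range (H.synthesisOp c).toLinearMap : Set (L2 f)) := by
    rw [LinearMap.coe_range]
    exact hanti.isClosed_range (H.synthesisOp c).uniformContinuous
  have hrange : LinearMap.range (H.synthesisOp c).toLinearMap = ⊤ := by
    rw [eq_top_iff, ← L2S_univ f]
    exact H.L2S_le_range hc hclosed _
  exact ⟨ContinuousLinearEquiv.ofBijective (H.synthesisOp c) hker hrange, fun x => rfl⟩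

end IsBoundedDensity

/-! ### The functions ξ as images of the orthonormal basis -/

/-- The factor between `ξ_S` and the Legendre tensor product divided by the averaged marginal. -/
def scale {p : ℕ} (κ : ℝ) (S : Finset (Fin p)) : ℝ :=
  if S = ∅ then κ / (Real.sqrt (1 / 2) ^ p * 2 ^ p) else 1 / 2 ^ (p - S.card)

theorem scale_ne_zero {p : ℕ} {κ : ℝ} (hκ : κ ≠ 0) (S : Finset (Fin p)) : scale κ S ≠ 0 := by
  unfold scale
  split_ifs
  · exact div_ne_zero hκ (by positivity)
  · positivity

namespace IsBoundedDensity

variable {p : ℕ} {f : (Fin p → ℝ) → ℝ} {c₁ c₂ : ℝ}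

theorem avgMarginal_empty (H : IsBoundedDensity f c₁ c₂)
    (hdens : ∫ x in Set.Icc (-1 : Fin p → ℝ) 1, f x = 1)
    (a : {j // j ∈ (∅ : Finset (Fin p))} → ℝ) : avgMarginal f ∅ a = 1 / 2 ^ p := by
  have h := integral_restrict_mul_density H.meas H.bound ∅ (h := fun _ => 1) (integrable_const _)
  have e : ∀ x : Fin p → ℝ, (∅ : Finset (Fin p)).restrict x = a := fun x =>
    funext fun j => absurd j.2 (Finset.notMem_empty _)
  simp only [one_mul, e] at h
  rw [integral_const, cube_real_univ, Fintype.card_fin, smul_eq_mul] at h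
  rw [eq_div_iff (by positivity), mul_comm, ← h]
  exact hdens

theorem xi_eq (H : IsBoundedDensity f c₁ c₂)
    (hdens : ∫ x in Set.Icc (-1 : Fin p → ℝ) 1, f x = 1) (κ : ℝ) (i : Idx p) (x : Fin p → ℝ) :
    xi f κ i x = scale κ i.1 * (tensor i.degree x * (avgMarginal f i.1 (i.1.restrict x))⁻¹) := by
  rw [tensor_degree_eq, xi, scale]
  obtain ⟨S, m⟩ := i
  -- For S = ∅ the quotient tensor / N_∅ is the constant √(1/2)^p · 2^p, which the scale trades for
  -- κ. Otherwise the factor 2^{p-|S|} from averaging is undone.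
  by_cases hS : S = ∅
  · subst hS
    simp only [if_true, H.avgMarginal_empty hdens, Finset.univ_eq_empty, Finset.prod_empty,
      Finset.card_empty, Nat.sub_zero]
    field_simp
  · simp only [hS, if_false, avgMarginal]
    have h2 : Real.sqrt (1 / 2) ^ (p - S.card) = 1 / Real.sqrt (2 ^ (p - S.card)) := by
      rw [one_div, Real.sqrt_inv, inv_pow, Real.sqrt_eq_rpow, Real.sqrt_eq_rpow,
        ← Real.rpow_natCast, ← Real.rpow_natCast, ← Real.rpow_mul (by norm_num),
        ← Real.rpow_mul (by norm_num), mul_comm, one_div, one_div]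
    rw [h2, inv_div]
    simp only [Finset.restrict]
    field_simp

theorem memLp_xi (H : IsBoundedDensity f c₁ c₂)
    (hdens : ∫ x in Set.Icc (-1 : Fin p → ℝ) 1, f x = 1) (κ : ℝ) (i : Idx p) :
    MemLp (xi f κ i) 2 (muF f) := by
  rw [funext (H.xi_eq hdens κ i)]
  exact H.memLp_two ((IsMultiplier.of_continuous continuous_const).mul
    ((IsMultiplier.of_continuous (continuous_tensor _)).mul (H.isMultiplier_inv_avgMarginal _)))

theorem toLp_xi (H : IsBoundedDensity f c₁ c₂)
    (hdens : ∫ x in Set.Icc (-1 : Fin p → ℝ) 1, f x = 1) (κ : ℝ) (i : Idx p) :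
    (H.memLp_xi hdens κ i).toLp (xi f κ i) = scale κ i.1 • H.dualOp i.1 (H.legendreBasis i) := by
  apply Lp.ext
  filter_upwards [(H.memLp_xi hdens κ i).coeFn_toLp, H.coeFn_dualOp_legendreBasis i i.1,
    Lp.coeFn_smul (scale κ i.1) (H.dualOp i.1 (H.legendreBasis i))] with x h1 h2 h3
  rw [h1, h3, Pi.smul_apply, h2, H.xi_eq hdens, smul_eq_mul, div_eq_mul_inv]

/-- A feasible family is determined by its sum. -/
theorem eq_of_sum_eq (H : IsBoundedDensity f c₁ c₂) {g g' : Finset (Fin p) → L2 f}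
    (hg : ∀ S, g S ∈ hierarchicalSpace f S) (hg' : ∀ S, g' S ∈ hierarchicalSpace f S)
    (h : ∑ S, g S = ∑ S, g' S) : g = g' := by
  obtain ⟨K, -, hK⟩ := H.exists_norm_le_sum Finset.univ
  funext S
  have := hK (fun S => g S - g' S) (fun S => Submodule.sub_mem _ (hg S) (hg' S)) S
    (Finset.mem_univ S)
  rw [Finset.sum_sub_distrib, h, sub_self, norm_zero, mul_zero] at this
  exact sub_eq_zero.1 (norm_le_zero_iff.1 this)

end IsBoundedDensity

/-! ### The variational problem and uniqueness of coefficients -/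

theorem objective_eq {p : ℕ} {f : (Fin p → ℝ) → ℝ} (ν : L2 f) (g : Finset (Fin p) → L2 f) :
    objective f ν g = ‖∑ S, g S - ν‖ ^ 2 := by
  rw [← real_inner_self_eq_norm_sq, inner_eq_integral, objective]
  refine integral_congr_ae ?_
  filter_upwards [Lp.coeFn_sub (∑ S, g S) ν, Lp.coeFn_finsetSum Finset.univ g] with x h1 h2
  rw [h1, Pi.sub_apply, h2, Finset.sum_apply]
  ring

/-- If the objective vanishes for some feasible family, the solutions are the exact feasible
decompositions. -/
theorem isSolution_iff {p : ℕ} {f : (Fin p → ℝ) → ℝ} {ν : L2 f} {g : Finset (Fin p) → L2 f}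
    (hg : Feasible f g) (hsum : ∑ S, g S = ν) (g' : Finset (Fin p) → L2 f) :
    IsSolution f ν g' ↔ Feasible f g' ∧ ∑ S, g' S = ν := by
  have h0 : objective f ν g = 0 := by rw [objective_eq, hsum]; simp
  refine ⟨fun h => ⟨h.1, ?_⟩, fun h => ⟨h.1, fun g'' _ => ?_⟩⟩
  · have h1 := h.2 g hg
    rw [h0, objective_eq] at h1
    have h2 : ‖∑ S, g' S - ν‖ = 0 := by
      have := norm_nonneg (∑ S, g' S - ν)
      nlinarith
    exact sub_eq_zero.1 (norm_eq_zero.1 h2)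
  · rw [objective_eq, h.2, objective_eq]
    simp

theorem eq_inner_of_hasSum_smul {ι E : Type*} [NormedAddCommGroup E]
    [InnerProductSpace ℝ E] {v : ι → E} (hv : Orthonormal ℝ v) {x : E} {a : ι → ℝ}
    (h : HasSum (fun i => a i • v i) x) (i : ι) : a i = inner ℝ (v i) x := by
  classical
  have h1 := h.mapL (innerSL ℝ (v i))
  simp only [map_smul, innerSL_apply_apply, orthonormal_iff_ite.1 hv, smul_eq_mul,
    mul_ite, mul_one, mul_zero] at h1
  have h2 : HasSum (fun j => if i = j then a j else 0) (a i) := by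
    have := hasSum_single (f := fun j => if i = j then a j else 0) i
      fun j hj => if_neg (Ne.symm hj)
    simpa using this
  exact h2.unique h1

theorem hasSum_smul_hilbertBasis_iff {ι E : Type*} [NormedAddCommGroup E] [InnerProductSpace ℝ E]
    (b : HilbertBasis ι ℝ E) (x : E) (a : ι → ℝ) :
    HasSum (fun i => a i • b i) x ↔ a = fun i => b.repr x i := by
  constructor
  · intro h
    funext i
    rw [b.repr_apply_apply]
    exact eq_inner_of_hasSum_smul b.orthonormal h i
  · rintro rfl
    exact b.hasSum_repr x

end FANOVA

end

/-! ### Assembly of the theorem -/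

theorem theorem1 (p : ℕ) (f : (Fin p → ℝ) → ℝ) (c₁ c₂ : ℝ) (hc₁ : 0 < c₁)
    (hf : Measurable f)
    (hbound : ∀ x ∈ Set.Icc (-1 : Fin p → ℝ) 1, c₁ ≤ f x ∧ f x ≤ c₂)
    (hdens : ∫ x in Set.Icc (-1 : Fin p → ℝ) 1, f x = 1)
    (κ : ℝ) (hκ : κ = 1 ∨ κ = 1 / Real.sqrt (2 ^ p)) :
    ∃ hξ : ∀ i : Idx p, MemLp (xi f κ i) 2 (muF f),
      IsRieszBasis (fun i : Idx p => (hξ i).toLp (xi f κ i)) ∧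
      ∀ ν : L2 f, ∃ (a : Idx p → ℝ) (g : Finset (Fin p) → L2 f),
        -- `a` is the unique coefficient family of `ν` in the basis
        (∀ b : Idx p → ℝ, HasSum (fun i => b i • (hξ i).toLp (xi f κ i)) ν ↔ b = a) ∧
        -- `g` is the unique solution of the constrained optimization problem
        (∀ g' : Finset (Fin p) → L2 f, IsSolution f ν g' ↔ g' = g) ∧
        -- `g` is the unique hierarchically orthogonal decomposition of `ν`
        (∀ g' : Finset (Fin p) → L2 f, (Feasible f g' ∧ ∑ S, g' S = ν) ↔ g' = g) ∧
        -- the components have the coefficients `a`, and `a` is the only such family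
        (∀ b : Idx p → ℝ, (∀ S : Finset (Fin p),
          HasSum (fun m : {j // j ∈ S} → ℕ+ => b ⟨S, m⟩ • (hξ ⟨S, m⟩).toLp (xi f κ ⟨S, m⟩))
            (g S)) ↔ b = a) := by
  have H : IsBoundedDensity f c₁ c₂ := ⟨hc₁, hf, hbound⟩
  have hκ0 : κ ≠ 0 := by
    rcases hκ with rfl | rfl
    · exact one_ne_zero
    · positivity
  obtain ⟨A, hA⟩ := H.exists_synthesisEquiv (scale_ne_zero (p := p) hκ0)
  have hAb : ∀ i, (H.memLp_xi hdens κ i).toLp (xi f κ i) = A (H.legendreBasis i) := fun i => by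
    rw [hA, H.synthesisOp_legendreBasis, H.toLp_xi hdens]
  refine ⟨H.memLp_xi hdens κ, ⟨H.legendreBasis, A, hAb⟩, fun ν => ?_⟩
  simp only [hAb]
  -- The terms of the synthesis operator at the preimage of ν.
  let g : Finset (Fin p) → L2 f := fun S =>
    scale κ S • H.dualOp S (H.levelProj S (A.symm ν))
  have hg : ∀ S, g S ∈ hierarchicalSpace f S := fun S =>
    Submodule.smul_mem _ _ (H.dualOp_levelProj_mem S _)
  have hsum : ∑ S, g S = ν := by
    rw [← H.synthesisOp_apply, ← hA, A.apply_symm_apply]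
  have hcomp : ∀ S, HasSum (fun m : {j // j ∈ S} → ℕ+ =>
      H.legendreBasis.repr (A.symm ν) ⟨S, m⟩ • A (H.legendreBasis ⟨S, m⟩)) (g S) := by
    intro S
    have h := (H.hasSum_levelProj S (A.symm ν)).mapL (scale κ S • H.dualOp S)
    simp only [map_smul, smul_apply] at h
    simpa only [hA, H.synthesisOp_legendreBasis] using h
  have hdec : ∀ g' : Finset (Fin p) → L2 f, (Feasible f g' ∧ ∑ S, g' S = ν) ↔ g' = g := by
    intro g'
    rw [feasible_iff]
    constructor
    · rintro ⟨h1, h2⟩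
      exact H.eq_of_sum_eq h1 hg (h2.trans hsum.symm)
    · rintro rfl
      exact ⟨hg, hsum⟩
  refine ⟨fun i => H.legendreBasis.repr (A.symm ν) i, g, fun b => ?_, fun g' => ?_, hdec,
    fun b => ⟨fun h => ?_, ?_⟩⟩
  · rw [← hasSum_smul_hilbertBasis_iff]
    simp only [← map_smul]
    exact A.hasSum
  · rw [isSolution_iff (feasible_iff.2 hg) hsum, hdec]
  · funext ⟨S, m⟩
    have hinj : Function.Injective (fun m : {j // j ∈ S} → ℕ+ => (⟨S, m⟩ : Idx p)) :=
      fun m n h => eq_of_heq (Sigma.mk.inj h).2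
    -- Pulled back by A⁻¹, the expansion of a single component is orthonormal, so each coefficient
    -- is an inner product.
    have key : ∀ c : Idx p → ℝ, HasSum (fun m : {j // j ∈ S} → ℕ+ =>
        c ⟨S, m⟩ • A (H.legendreBasis ⟨S, m⟩)) (g S) →
        c ⟨S, m⟩ = inner ℝ (H.legendreBasis ⟨S, m⟩) (A.symm (g S)) := by
      intro c hc
      have h1 := hc.mapL A.symm.toContinuousLinearMap
      simp only [map_smul, ContinuousLinearEquiv.coe_coe, A.symm_apply_apply] at h1
      exact eq_inner_of_hasSum_smul (H.legendreBasis.orthonormal.comp _ hinj)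
        (a := fun m => c ⟨S, m⟩) h1 m
    rw [key b (h S), key _ (hcomp S)]
  · rintro rfl
    exact hcomp
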